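/- Let $\beta>0$ and $n\ge 1$. Let $\mu=\sum_{i=1}^n w_i\,\delta_{\lambda_i}$ be the random spectral measure of the Gaussian $\beta$-ensemble ($\mu\sim G\beta E_n$): the support points $\lambda=(\lambda_1,\dots,\lambda_n)$ have joint density proportional to $\prod_{i<j}|\lambda_j-\lambda_i|^{\beta}\prod_{i=1}^n e^{-\lambda_i^2/2}$ on $\mathbb R^n$, the weights $w=(w_1,\dots,w_n)$ are independent of $\lambda$ and have the Dirichlet density $\frac{\Gamma(n\beta/2)}{\Gamma(\beta/2)^n}\prod_{i=1}^n w_i^{\beta/2-1}$ (with respect to $dw_1\cdots dw_{n-1}$) on the simplex $\{w_i>0,\ \sum_i w_i=1\}$. Let $\mathcal M_{2n-1}(\mathbb R)\subset\mathbb R^{2n-1}$ be the set of vectors $\vec m_{2n-1}(\nu)=(m_1(\nu),\dots,m_{2n-1}(\nu))$, $m_k(\nu)=\int x^k\,d\nu$, where $\nu$ runs through the probability measures on $\mathbb R$ with moments of all orders. For $\vec m$ in the interior of $\mathcal M_{2n-1}(\mathbb R)$ let $P_0=1,P_1,\dots,P_n$ be the associated monic orthogonal polynomials and let $b_k=b_k(\vec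 m)$ $(1\le k\le n)$ and $a_k=a_k(\vec m)$ $(1\le k\le n-1)$ be the coefficients of their recursion $xP_k=P_{k+1}+b_{k+1}P_k+a_kP_{k-1}$ (with $P_1=x-b_1$); equivalently, $\int x^kP_k\,d\nu=a_1\cdots a_k$ $(1\le k\le n-1)$ and $\int x^{k+1}P_k\,d\nu=a_1\cdots a_k(b_1+\dots+b_{k+1})$ $(0\le k\le n-1)$ for every $\nu$ with moment vector $\vec m$. Put $$h_{2n-1}^{(\gamma,\delta)}(\vec m)=\prod_{k=1}^n\sqrt{\tfrac{\delta_{2k-1}}{\pi}}\;e^{-\delta_{2k-1}b_k^2}\;\prod_{k=1}^{n-1}\frac{\delta_{2k}^{\gamma_k+2n-2k}}{\Gamma(\gamma_k+2n-2k)}\,a_k^{\gamma_k}\,e^{-\delta_{2k}a_k}\,\mathbf 1_{\{a_k>0\}} .$$ Then the distribution of the random moment vector $\vec m_{2n-1}(\mu)$ on $\mathcal M_{2n-1}(\mathbb R)$ is absolutely continuous with respect to Lebesgue measure, with density $h_{2n-1}^{(\gamma,\delta)}$, where $\delta_{2k-1}=\tfrac12$ for $1\le k\le n$, and $\delta_{2k}=1$,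 $\gamma_k=\left(\tfrac{\beta}{2}-2\right)(n-k)$ for $1\le k\le n-1$. -/

import Mathlib

open MeasureTheory ProbabilityTheory Polynomial
open scoped ENNReal

noncomputable section

namespace RandomMoments

/-! ### Moment spaces of the real line -/

/-- `(m_1(μ), …, m_N(μ))`; the entry with index `i : Fin N` is the moment of order `i + 1`. -/
def momentVector (N : ℕ) (μ : Measure ℝ) : Fin N → ℝ :=
  fun i => ∫ x, x ^ ((i : ℕ) + 1) ∂μ

/-- The `N`-th moment space of `ℝ`: all vectors of the first `N` moments of probability measures
on `ℝ` all of whose moments exist. -/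
def momentSpace (N : ℕ) : Set (Fin N → ℝ) :=
  {m | ∃ μ : Measure ℝ, IsProbabilityMeasure μ ∧ (∀ k : ℕ, Integrable (fun x : ℝ => x ^ k) μ) ∧
    momentVector N μ = m}

/-! ### Orthogonal polynomials and recursion coefficients of a moment vector -/

/-- The moment of order `j` read off from a vector `m = (m_1, …, m_N)`, with `m_0 = 1`
(and `0` for the orders `j > N`, which are never used below). -/
def momentOf {N : ℕ} (m : Fin N → ℝ) : ℕ → ℝ
  | 0 => 1
  | j + 1 => if h : j < N then m ⟨j, h⟩ else 0

/-- The linear functional `x ^ j ↦ m_j` on polynomials. For polynomials of degree at most `N` it is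
`p ↦ ∫ p dμ`, for every measure `μ` whose first `N` moments are given by `m`. -/
def momentFunctional {N : ℕ} (m : Fin N → ℝ) (p : ℝ[X]) : ℝ :=
  p.sum fun j c => c * momentOf m j

/-- The Hankel determinant `det (m_{i+j})_{0 ≤ i, j ≤ k - 1}`. -/
def hankelDet {N : ℕ} (m : Fin N → ℝ) (k : ℕ) : ℝ :=
  (Matrix.of fun i j : Fin k => momentOf m ((i : ℕ) + (j : ℕ))).det

/-- The monic orthogonal polynomial `P_k`: the determinant of the `(k+1) × (k+1)` matrix whose rows
are `(m_i, m_{i+1}, …, m_{i+k-1}, x ^ i)`, `0 ≤ i ≤ k`, divided by the Hankel determinant. -/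
def orthoPoly {N : ℕ} (m : Fin N → ℝ) (k : ℕ) : ℝ[X] :=
  C (hankelDet m k)⁻¹ *
    (Matrix.of fun i j : Fin (k + 1) =>
      if (j : ℕ) < k then C (momentOf m ((i : ℕ) + (j : ℕ))) else (X : ℝ[X]) ^ (i : ℕ)).det

/-- The coefficient `a_k` (`k ≥ 1`) of the recursion `x P_k = P_{k+1} + b_{k+1} P_k + a_k P_{k-1}`,
determined by `∫ x ^ k P_k dμ = a_1 ⋯ a_k`. The value at `k = 0` is not used. -/
def recA {N : ℕ} (m : Fin N → ℝ) : ℕ → ℝ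
  | 0 => 0
  | k + 1 => momentFunctional m (X ^ (k + 1) * orthoPoly m (k + 1)) /
      momentFunctional m (X ^ k * orthoPoly m k)

/-- The coefficient `b_k` (`k ≥ 1`) of the recursion `x P_k = P_{k+1} + b_{k+1} P_k + a_k P_{k-1}`,
determined by `∫ x ^ (k+1) P_k dμ = a_1 ⋯ a_k (b_1 + ⋯ + b_{k+1})`.
The value at `k = 0` is not used. -/
def recB {N : ℕ} (m : Fin N → ℝ) : ℕ → ℝ
  | 0 => 0
  | 1 => momentFunctional m (X * orthoPoly m 0)
  | k + 2 =>
      momentFunctional m (X ^ (k + 2) * orthoPoly m (k + 1)) /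
          momentFunctional m (X ^ (k + 1) * orthoPoly m (k + 1)) -
        momentFunctional m (X ^ (k + 1) * orthoPoly m k) /
          momentFunctional m (X ^ k * orthoPoly m k)

/-- The density `h_{2n-1}^{(γ, δ)}` on the moment space `M_{2n-1}(ℝ)`. -/
def hDensity (n : ℕ) (γ δ : ℕ → ℝ) (m : Fin (2 * n - 1) → ℝ) : ℝ :=
  (∏ k ∈ Finset.Icc 1 n,
      Real.sqrt (δ (2 * k - 1) / Real.pi) * Real.exp (-(δ (2 * k - 1)) * recB m k ^ 2)) *
    ∏ k ∈ Finset.Icc 1 (n - 1),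
      δ (2 * k) ^ (γ k + 2 * (n : ℝ) - 2 * (k : ℝ)) /
          Real.Gamma (γ k + 2 * (n : ℝ) - 2 * (k : ℝ)) *
        recA m k ^ γ k * Real.exp (-(δ (2 * k)) * recA m k) *
        (if 0 < recA m k then 1 else 0)

/-! ### The random spectral measure of the Gaussian ensemble -/

/-- `|Δ(x)|^β ∏ᵢ exp(-xᵢ²/2)` with the Vandermonde determinant `Δ(x) = ∏_{i<j} (x_j - x_i)`. -/
def hermiteWeight (β : ℝ) (n : ℕ) (x : Fin n → ℝ) : ℝ :=
  |∏ i : Fin n, ∏ j ∈ Finset.Ioi i, (x j - x i)| ^ β * ∏ i : Fin n, Real.exp (-(x i) ^ 2 / 2)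

/-- The distribution of the eigenvalues of the Gaussian `β`-ensemble: the probability measure with
Lebesgue density `c_G |Δ(x)|^β ∏ᵢ exp(-xᵢ²/2)`, where `c_G` is the normalizing constant. -/
def hermiteEnsemble (β : ℝ) (n : ℕ) : Measure (Fin n → ℝ) :=
  volume.withDensity fun x =>
    ENNReal.ofReal ((∫ y : Fin n → ℝ, hermiteWeight β n y)⁻¹ * hermiteWeight β n x)

/-- `(w_1, …, w_{n-1}) ↦ (w_1, …, w_{n-1}, 1 - w_1 - ⋯ - w_{n-1})`. -/
def completeWeights (n : ℕ) (v : Fin (n - 1) → ℝ) : Fin n → ℝ :=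
  fun i => if h : (i : ℕ) < n - 1 then v ⟨i, h⟩ else 1 - ∑ j, v j

/-- The symmetric Dirichlet distribution on the open simplex `{w | wᵢ > 0, ∑ wᵢ = 1}` of `ℝⁿ`, with
density `Γ(nβ/2) / Γ(β/2)^n ∏ᵢ wᵢ^(β/2-1)` with respect to `dw_1 ⋯ dw_{n-1}`. -/
def dirichletWeights (β : ℝ) (n : ℕ) : Measure (Fin n → ℝ) :=
  ((volume : Measure (Fin (n - 1) → ℝ)).withDensity fun v =>
    ENNReal.ofReal
      (Real.Gamma (n * β / 2) / Real.Gamma (β / 2) ^ n *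
        (∏ i : Fin n, completeWeights n v i ^ (β / 2 - 1)) *
        (if ∀ i : Fin n, 0 < completeWeights n v i then 1 else 0))).map (completeWeights n)

/-- The discrete measure `∑ᵢ wᵢ δ_{λᵢ}`. -/
def discreteMeasure {n : ℕ} (x w : Fin n → ℝ) : Measure ℝ :=
  ∑ i, ENNReal.ofReal (w i) • Measure.dirac (x i)

/-- The law `GβE_n` of the random spectral measure of the Gaussian ensemble, a distribution on the
space of measures on `ℝ`: the law of `∑ᵢ wᵢ δ_{λᵢ}` where the support points `λ` follow the
Gaussian `β`-ensemble, the weights `w` follow the Dirichlet distribution, and `λ`, `w` are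
independent. -/
def gaussianSpectralLaw (β : ℝ) (n : ℕ) : Measure (Measure ℝ) :=
  ((hermiteEnsemble β n).prod (dirichletWeights β n)).map fun q => discreteMeasure q.1 q.2

end RandomMoments

end

noncomputable section

namespace RandomMoments

/-! The moments are computed in two coordinate systems. In the first, a moment vector with positive
Hankel determinants comes from `n` nodes and positive weights, uniquely once the order of the nodes
is fixed (Gaussian quadrature: `exists_nodeMoments_eq`, `nodes_injective`). The Jacobian of this map
is `∏ w · Δ ^ 4` (`abs_det_nodeFunctional`), while the Hankel determinant is `D = ∏ w · Δ ^ 2`.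
Dividing the joint density, proportional to `∏ w ^ (β/2 - 1) · Δ ^ β · exp (-∑ x ^ 2 / 2)`, by the
Jacobian leaves a constant times `D ^ (β/2 - 2) · exp (-∑ x ^ 2 / 2)`. Since `D = ∏ a_k ^ (n - k)`
(`hankelDet_rpow`) and `∑ x ^ 2 = ∑ b_k ^ 2 + 2 ∑ a_k`, the trace of the squared Jacobi matrix
(`sum_sq_nodes`), this is `h` up to a constant (`spectralDensity_eq`). Each of the `n!` orderings of
the nodes contributes the same amount.

The constant is found without evaluating a Selberg integral. In the second coordinate system, that
of the recursion coefficients, the moment map is triangular, and `h` becomes a product of Gaussian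
and Gamma densities (`hDensity_eq_mul_coordDensity`). Hence `h` has total mass one
(`lintegral_hDensity`). The law of the moments is a probability measure proportional to `h`, so the
factor is one. -/

/-- The moment functional as a linear map. -/
def momentLin {N : ℕ} (m : Fin N → ℝ) : ℝ[X] →ₗ[ℝ] ℝ :=
  Polynomial.lsum fun j => LinearMap.mulRight ℝ (momentOf m j)

theorem momentFunctional_eq_momentLin {N : ℕ} (m : Fin N → ℝ) (p : ℝ[X]) :
    momentFunctional m p = momentLin m p := rfl

theorem momentLin_X_pow {N : ℕ} (m : Fin N → ℝ) (j : ℕ) :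
    momentLin m (X ^ j) = momentOf m j := by
  rw [← momentFunctional_eq_momentLin, momentFunctional, ← monomial_one_right_eq_X_pow,
    sum_monomial_index _ _ (by simp), one_mul]

theorem momentLin_C_mul {N : ℕ} (m : Fin N → ℝ) (c : ℝ) (p : ℝ[X]) :
    momentLin m (C c * p) = c * momentLin m p := by
  rw [← smul_eq_C_mul, map_smul, smul_eq_mul]

theorem momentLin_X_pow_mul {N : ℕ} (m : Fin N → ℝ) (j d : ℕ) (p : ℝ[X]) (hp : p.natDegree < d) :
    momentLin m (X ^ j * p) = ∑ i ∈ Finset.range d, p.coeff i * momentOf m (j + i) := by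
  conv_lhs => rw [p.as_sum_range' d hp, Finset.mul_sum]
  rw [map_sum]
  refine Finset.sum_congr rfl fun i _ => ?_
  rw [← C_mul_X_pow_eq_monomial, mul_left_comm, ← pow_add, momentLin_C_mul, momentLin_X_pow]

/-! ### Orthogonal polynomials as determinants -/

/-- Cofactors of the last column of the matrix defining `orthoPoly`. -/
def orthoCof {N : ℕ} (m : Fin N → ℝ) (k : ℕ) (i : Fin (k + 1)) : ℝ :=
  (-1) ^ ((i : ℕ) + k) *
    (Matrix.of fun r c : Fin k => momentOf m ((i.succAbove r : ℕ) + (c : ℕ))).det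

/-- The ring homomorphism allows two uses with the same real cofactors: `C` for the polynomial
matrix, and the identity for the matrix obtained after integrating its last column. -/
theorem det_lastColumn {N : ℕ} {R : Type*} [CommRing R] (f : ℝ →+* R) (m : Fin N → ℝ) (k : ℕ)
    (y : Fin (k + 1) → R) :
    (Matrix.of fun i j : Fin (k + 1) =>
      if (j : ℕ) < k then f (momentOf m ((i : ℕ) + (j : ℕ))) else y i).det =
      ∑ i, f (orthoCof m k i) * y i := by
  rw [Matrix.det_succ_column _ (Fin.last k)]
  refine Finset.sum_congr rfl fun i _ => ?_
  have : (Matrix.of fun i j : Fin (k + 1) =>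
      if (j : ℕ) < k then f (momentOf m ((i : ℕ) + (j : ℕ))) else y i).submatrix i.succAbove
        (Fin.last k).succAbove =
      f.mapMatrix (Matrix.of fun r c : Fin k => momentOf m ((i.succAbove r : ℕ) + (c : ℕ))) := by
    ext r c
    simp [Matrix.submatrix_apply]
  rw [this, ← RingHom.map_det, orthoCof]
  simp
  ring

theorem orthoCof_last {N : ℕ} (m : Fin N → ℝ) (k : ℕ) :
    orthoCof m k (Fin.last k) = hankelDet m k := by
  simp [orthoCof, hankelDet, ← two_mul, pow_mul]

theorem orthoPoly_eq_sum {N : ℕ} (m : Fin N → ℝ) (k : ℕ) :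
    orthoPoly m k = C (hankelDet m k)⁻¹ * ∑ i : Fin (k + 1), C (orthoCof m k i) * X ^ (i : ℕ) := by
  rw [orthoPoly, ← det_lastColumn C m k fun i => (X : ℝ[X]) ^ (i : ℕ)]

theorem hankelDet_zero {N : ℕ} (m : Fin N → ℝ) : hankelDet m 0 = 1 := by simp [hankelDet]

theorem hankelDet_one {N : ℕ} (m : Fin N → ℝ) : hankelDet m 1 = 1 := by
  simp [hankelDet, momentOf]

theorem orthoPoly_zero {N : ℕ} (m : Fin N → ℝ) : orthoPoly m 0 = 1 := by
  simp [orthoPoly, hankelDet_zero]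

theorem natDegree_orthoPoly_le {N : ℕ} (m : Fin N → ℝ) (k : ℕ) :
    (orthoPoly m k).natDegree ≤ k := by
  rw [orthoPoly_eq_sum]
  refine (natDegree_C_mul_le _ _).trans (natDegree_sum_le_of_forall_le _ _ fun i _ => ?_)
  exact (natDegree_C_mul_X_pow_le _ _).trans (Nat.lt_succ_iff.1 i.2)

theorem coeff_orthoPoly {N : ℕ} (m : Fin N → ℝ) (k : ℕ) (i : Fin (k + 1)) :
    (orthoPoly m k).coeff i = (hankelDet m k)⁻¹ * orthoCof m k i := by
  rw [orthoPoly_eq_sum, coeff_C_mul, finsetSum_coeff]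
  congr 1
  rw [Finset.sum_eq_single i]
  · simp
  · intro b _ hb
    rw [coeff_C_mul_X_pow, if_neg fun h => hb (Fin.ext h.symm)]
  · simp

theorem coeff_orthoPoly_self {N : ℕ} {m : Fin N → ℝ} {k : ℕ} (h : hankelDet m k ≠ 0) :
    (orthoPoly m k).coeff k = 1 := by
  have := coeff_orthoPoly m k (Fin.last k)
  rw [orthoCof_last, inv_mul_cancel₀ h] at this
  simpa using this

theorem natDegree_orthoPoly {N : ℕ} {m : Fin N → ℝ} {k : ℕ} (h : hankelDet m k ≠ 0) :
    (orthoPoly m k).natDegree = k :=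
  natDegree_eq_of_le_of_coeff_ne_zero (natDegree_orthoPoly_le m k)
    (by rw [coeff_orthoPoly_self h]; exact one_ne_zero)

theorem monic_orthoPoly {N : ℕ} {m : Fin N → ℝ} {k : ℕ} (h : hankelDet m k ≠ 0) :
    (orthoPoly m k).Monic := by
  rw [Monic, leadingCoeff, natDegree_orthoPoly h, coeff_orthoPoly_self h]

/-- The determinant is linear in its last column, so integration against `x ^ j` can be carried out
inside that column. For `j < k` the result has two equal columns, which is the orthogonality of
`P_k`. -/
theorem momentLin_X_pow_mul_orthoPoly {N : ℕ} (m : Fin N → ℝ) (j k : ℕ) :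
    momentLin m (X ^ j * orthoPoly m k) = (hankelDet m k)⁻¹ *
      (Matrix.of fun i c : Fin (k + 1) =>
        if (c : ℕ) < k then momentOf m ((i : ℕ) + (c : ℕ)) else momentOf m ((i : ℕ) + j)).det := by
  have := det_lastColumn (RingHom.id ℝ) m k fun i => momentOf m ((i : ℕ) + j)
  simp only [RingHom.id_apply] at this
  rw [this, orthoPoly_eq_sum, mul_left_comm, momentLin_C_mul, Finset.mul_sum, map_sum]
  congr 1
  refine Finset.sum_congr rfl fun i _ => ?_
  rw [mul_left_comm, momentLin_C_mul, ← pow_add, momentLin_X_pow, add_comm]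

theorem momentLin_X_pow_mul_orthoPoly_of_lt {N : ℕ} (m : Fin N → ℝ) {j k : ℕ} (h : j < k) :
    momentLin m (X ^ j * orthoPoly m k) = 0 := by
  rw [momentLin_X_pow_mul_orthoPoly, Matrix.det_zero_of_column_eq (i := ⟨j, by omega⟩)
    (j := Fin.last k), mul_zero]
  · simp [Fin.ext_iff]; omega
  · intro i; simp [h]

theorem momentLin_mul_orthoPoly_of_natDegree_lt {N : ℕ} (m : Fin N → ℝ) {k : ℕ} {q : ℝ[X]}
    (h : q.natDegree < k) : momentLin m (q * orthoPoly m k) = 0 := by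
  rw [q.as_sum_range' k h, Finset.sum_mul, map_sum]
  refine Finset.sum_eq_zero fun i hi => ?_
  rw [← C_mul_X_pow_eq_monomial, mul_assoc, momentLin_C_mul,
    momentLin_X_pow_mul_orthoPoly_of_lt m (Finset.mem_range.1 hi), mul_zero]

/-! ### Norms and recursion coefficients as ratios -/

/-- `∫ x ^ k P_k`, the squared norm of the orthogonal polynomial `P_k`. -/
def orthoNorm {N : ℕ} (m : Fin N → ℝ) (k : ℕ) : ℝ := momentLin m (X ^ k * orthoPoly m k)

theorem orthoNorm_eq {N : ℕ} (m : Fin N → ℝ) (k : ℕ) :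
    orthoNorm m k = (hankelDet m k)⁻¹ * hankelDet m (k + 1) := by
  rw [orthoNorm, momentLin_X_pow_mul_orthoPoly, hankelDet.eq_def _ (k + 1)]
  congr 3
  ext i c
  rcases Nat.lt_or_ge c k with h | h
  · simp [h]
  · simp [show (c : ℕ) = k by omega]

theorem orthoNorm_zero {N : ℕ} (m : Fin N → ℝ) : orthoNorm m 0 = 1 := by
  simp [orthoNorm_eq, hankelDet_zero, hankelDet_one]

/-- `∫ x ^ (k + 1) P_k`. -/
def orthoNext {N : ℕ} (m : Fin N → ℝ) (k : ℕ) : ℝ := momentLin m (X ^ (k + 1) * orthoPoly m k)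

theorem recA_succ {N : ℕ} (m : Fin N → ℝ) (k : ℕ) :
    recA m (k + 1) = orthoNorm m (k + 1) / orthoNorm m k := rfl

theorem recB_one {N : ℕ} (m : Fin N → ℝ) : recB m 1 = orthoNext m 0 := by
  rw [orthoNext, zero_add, pow_one]; rfl

theorem recB_succ_succ {N : ℕ} (m : Fin N → ℝ) (k : ℕ) :
    recB m (k + 2) = orthoNext m (k + 1) / orthoNorm m (k + 1) - orthoNext m k / orthoNorm m k :=
  rfl

/-! ### Positive moment vectors -/

/-- The moment vectors whose first `n` Hankel determinants are positive. -/
def posMoments (N n : ℕ) : Set (Fin N → ℝ) := {m | ∀ k ≤ n, 0 < hankelDet m k}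

theorem orthoNorm_pos {N n : ℕ} {m : Fin N → ℝ} (hm : m ∈ posMoments N n) {k : ℕ} (hk : k < n) :
    0 < orthoNorm m k := by
  rw [orthoNorm_eq]
  exact mul_pos (inv_pos.2 (hm k hk.le)) (hm (k + 1) hk)

/-- The `a_k` are ratios of consecutive norms, and the norms are ratios of consecutive Hankel
determinants. Positivity therefore propagates upwards from the first two determinants, which are
both one. -/
theorem mem_posMoments_iff_recA {N n : ℕ} (m : Fin N → ℝ) :
    m ∈ posMoments N n ↔ ∀ k ∈ Finset.Icc 1 (n - 1), 0 < recA m k := by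
  constructor
  · intro hm k hk
    obtain ⟨k, rfl⟩ : ∃ j, k = j + 1 := ⟨k - 1, by simp at hk; omega⟩
    simp only [Finset.mem_Icc] at hk
    rw [recA_succ]
    exact div_pos (orthoNorm_pos hm (by omega)) (orthoNorm_pos hm (by omega))
  · intro h
    have key : ∀ k < n, 0 < hankelDet m k ∧ 0 < hankelDet m (k + 1) ∧ 0 < orthoNorm m k := by
      intro k
      induction k with
      | zero => intro _; simp [hankelDet_zero, hankelDet_one, orthoNorm_zero]
      | succ k ih =>
        intro hk
        obtain ⟨h0, h1, h2⟩ := ih (by omega)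
        have h3 := h (k + 1) (by simp; omega)
        rw [recA_succ] at h3
        have h4 : 0 < orthoNorm m (k + 1) := by
          rcases div_pos_iff.1 h3 with h | h
          · exact h.1
          · linarith [h.2]
        refine ⟨h1, ?_, h4⟩
        rw [orthoNorm_eq] at h4
        exact pos_of_mul_pos_right h4 (inv_pos.2 h1).le
    intro k hk
    cases k with
    | zero => simp [hankelDet_zero]
    | succ k => exact (key k (by omega)).2.1

theorem hankelDet_eq_prod {N n : ℕ} {m : Fin N → ℝ} (hm : m ∈ posMoments N n) {k : ℕ}
    (hk : k ≤ n) : hankelDet m k = ∏ j ∈ Finset.range k, orthoNorm m j := by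
  induction k with
  | zero => simp [hankelDet_zero]
  | succ k ih =>
    rw [Finset.prod_range_succ, ← ih (by omega), orthoNorm_eq,
      mul_inv_cancel_left₀ (hm k (by omega)).ne']

theorem orthoNorm_eq_prod {N n : ℕ} {m : Fin N → ℝ} (hm : m ∈ posMoments N n) {k : ℕ}
    (hk : k < n) : orthoNorm m k = ∏ j ∈ Finset.Icc 1 k, recA m j := by
  induction k with
  | zero => simp [orthoNorm_zero]
  | succ k ih =>
    rw [Finset.prod_Icc_succ_top (by omega), ← ih (by omega), recA_succ,
      mul_div_cancel₀ _ (orthoNorm_pos hm (by omega)).ne']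

/-! ### Dependence on the moments -/

theorem hankelDet_congr {N : ℕ} {m m' : Fin N → ℝ} {k : ℕ}
    (h : ∀ j, j + 2 ≤ 2 * k → momentOf m j = momentOf m' j) : hankelDet m k = hankelDet m' k := by
  unfold hankelDet
  congr 2
  ext i j
  exact h _ (by omega)

theorem orthoPoly_congr {N : ℕ} {m m' : Fin N → ℝ} {k : ℕ}
    (h : ∀ j, j < 2 * k → momentOf m j = momentOf m' j) : orthoPoly m k = orthoPoly m' k := by
  unfold orthoPoly
  rw [hankelDet_congr fun j hj => h j (by omega)]
  congr 3
  funext i j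
  split_ifs with hj
  · rw [h _ (by omega)]
  · rfl

theorem orthoNorm_congr {N : ℕ} {m m' : Fin N → ℝ} {k : ℕ}
    (h : ∀ j ≤ 2 * k, momentOf m j = momentOf m' j) : orthoNorm m k = orthoNorm m' k := by
  rw [orthoNorm_eq, orthoNorm_eq, hankelDet_congr fun j hj => h j (by omega),
    hankelDet_congr fun j hj => h j (by omega)]

theorem orthoNext_eq_sum {N : ℕ} (m : Fin N → ℝ) (k : ℕ) : orthoNext m k =
    ∑ i ∈ Finset.range (k + 1), (orthoPoly m k).coeff i * momentOf m (k + 1 + i) :=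
  momentLin_X_pow_mul m _ _ _ (Nat.lt_succ_iff.2 (natDegree_orthoPoly_le m k))

theorem orthoNorm_eq_sum {N : ℕ} (m : Fin N → ℝ) (k : ℕ) : orthoNorm m k =
    ∑ i ∈ Finset.range (k + 1), (orthoPoly m k).coeff i * momentOf m (k + i) :=
  momentLin_X_pow_mul m _ _ _ (Nat.lt_succ_iff.2 (natDegree_orthoPoly_le m k))

theorem orthoNext_congr {N : ℕ} {m m' : Fin N → ℝ} {k : ℕ}
    (h : ∀ j ≤ 2 * k + 1, momentOf m j = momentOf m' j) : orthoNext m k = orthoNext m' k := by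
  rw [orthoNext_eq_sum, orthoNext_eq_sum, orthoPoly_congr fun j hj => h j (by omega)]
  refine Finset.sum_congr rfl fun i hi => ?_
  rw [h _ (by simp at hi; omega)]

theorem recA_congr {N : ℕ} {m m' : Fin N → ℝ} {k : ℕ}
    (h : ∀ j ≤ 2 * k, momentOf m j = momentOf m' j) : recA m k = recA m' k := by
  cases k with
  | zero => rfl
  | succ k => rw [recA_succ, recA_succ, orthoNorm_congr h, orthoNorm_congr fun j hj => h j (by omega)]

theorem recB_congr {N : ℕ} {m m' : Fin N → ℝ} {k : ℕ}
    (h : ∀ j, j < 2 * k → momentOf m j = momentOf m' j) : recB m k = recB m' k := by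
  match k with
  | 0 => rfl
  | 1 => rw [recB_one, recB_one, orthoNext_congr fun j hj => h j (by omega)]
  | k + 2 =>
    rw [recB_succ_succ, recB_succ_succ, orthoNext_congr fun j hj => h j (by omega),
      orthoNorm_congr fun j hj => h j (by omega), orthoNext_congr fun j hj => h j (by omega),
      orthoNorm_congr fun j hj => h j (by omega)]

/-! ### The three-term recursion -/

/-- The coefficient vector of `q` lies in the kernel of the nonsingular Hankel matrix. This
uniqueness principle yields both the recursion and the identification of `P_n` with the nodal
polynomial. -/
theorem eq_zero_of_momentLin_eq_zero {N : ℕ} {m : Fin N → ℝ} {k : ℕ} (hk : hankelDet m k ≠ 0)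
    {q : ℝ[X]} (hq : q.degree < k) (h : ∀ j < k, momentLin m (X ^ j * q) = 0) : q = 0 := by
  rcases eq_or_ne q 0 with rfl | h0
  · rfl
  have hd : q.natDegree < k := (natDegree_lt_iff_degree_lt h0).2 hq
  have hv : (Matrix.of fun i j : Fin k => momentOf m ((i : ℕ) + (j : ℕ))).mulVec
      (fun i : Fin k => q.coeff i) = 0 := by
    ext i
    have := h i i.2
    rw [momentLin_X_pow_mul m i k q hd, Finset.sum_range] at this
    simp only [Matrix.mulVec, dotProduct, Matrix.of_apply, Pi.zero_apply]
    rw [← this]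
    exact Finset.sum_congr rfl fun j _ => mul_comm _ _
  have hz := Matrix.eq_zero_of_mulVec_eq_zero (M := Matrix.of fun i j : Fin k =>
    momentOf m ((i : ℕ) + (j : ℕ))) hk hv
  ext i
  rcases lt_or_ge i k with hi | hi
  · simpa using congrFun hz ⟨i, hi⟩
  · simpa using coeff_eq_zero_of_natDegree_lt (hd.trans_le hi)

theorem X_mul_orthoPoly_zero {N : ℕ} (m : Fin N → ℝ) :
    X * orthoPoly m 0 = orthoPoly m 1 + C (recB m 1) * orthoPoly m 0 := by
  have h1 : orthoPoly m 1 = X - C (recB m 1) := by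
    rw [orthoPoly, hankelDet_one, recB_one, orthoNext_eq_sum]
    simp [Matrix.det_fin_two, momentOf, orthoPoly_zero]
  rw [orthoPoly_zero, h1]; ring

/-- The difference of the two sides has degree below `k + 2`, as the leading terms cancel. It is
orthogonal to `x ^ j` for `j < k` automatically, for `j = k` by the choice of `a_{k+1}`, and for `j
= k + 1` by that of `b_{k+2}`. -/
theorem X_mul_orthoPoly_succ {N n : ℕ} {m : Fin N → ℝ} (hm : m ∈ posMoments N n) {k : ℕ}
    (hk : k + 2 ≤ n) :
    X * orthoPoly m (k + 1) = orthoPoly m (k + 2) + C (recB m (k + 2)) * orthoPoly m (k + 1) +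
      C (recA m (k + 1)) * orthoPoly m k := by
  have hD : ∀ j ≤ n, hankelDet m j ≠ 0 := fun j hj => (hm j hj).ne'
  have hn0 : orthoNorm m k ≠ 0 := (orthoNorm_pos hm (by omega)).ne'
  have hn1 : orthoNorm m (k + 1) ≠ 0 := (orthoNorm_pos hm (by omega)).ne'
  rw [← sub_eq_zero]
  refine eq_zero_of_momentLin_eq_zero (hD (k + 2) hk) ?_ ?_
  · rw [degree_lt_iff_coeff_zero]
    intro i hi
    have hc : ∀ j l, l < j → (orthoPoly m l).coeff j = 0 := fun j l hj =>
      coeff_eq_zero_of_natDegree_lt ((natDegree_orthoPoly_le m l).trans_lt hj)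
    obtain ⟨i, rfl⟩ : ∃ l, i = l + 1 := ⟨i - 1, by omega⟩
    simp only [coeff_sub, coeff_add, coeff_C_mul, coeff_X_mul]
    rw [hc (i + 1) (k + 1) (by omega), hc (i + 1) k (by omega)]
    rcases eq_or_lt_of_le hi with h | h
    · obtain rfl : i = k + 1 := by omega
      rw [coeff_orthoPoly_self (hD _ (by omega)), coeff_orthoPoly_self (hD _ hk)]; simp
    · rw [hc i _ (by omega), hc (i + 1) _ (by omega)]; simp
  · intro j hj
    have e : X ^ j * (X * orthoPoly m (k + 1) - (orthoPoly m (k + 2) +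
        C (recB m (k + 2)) * orthoPoly m (k + 1) + C (recA m (k + 1)) * orthoPoly m k)) =
        X ^ (j + 1) * orthoPoly m (k + 1) - X ^ j * orthoPoly m (k + 2) -
        C (recB m (k + 2)) * (X ^ j * orthoPoly m (k + 1)) -
        C (recA m (k + 1)) * (X ^ j * orthoPoly m k) := by ring
    rw [e, map_sub, map_sub, map_sub, momentLin_C_mul, momentLin_C_mul,
      momentLin_X_pow_mul_orthoPoly_of_lt m hj]
    rcases lt_trichotomy j k with h | rfl | h
    · rw [momentLin_X_pow_mul_orthoPoly_of_lt m h,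
        momentLin_X_pow_mul_orthoPoly_of_lt m (show j < k + 1 by omega),
        momentLin_X_pow_mul_orthoPoly_of_lt m (show j + 1 < k + 1 by omega)]
      ring
    · rw [momentLin_X_pow_mul_orthoPoly_of_lt m (show j < j + 1 by omega)]
      change orthoNorm m (j + 1) - 0 - _ * 0 - _ * orthoNorm m j = 0
      rw [recA_succ]; field_simp; ring
    · obtain rfl : j = k + 1 := by omega
      change orthoNext m (k + 1) - 0 - _ * orthoNorm m (k + 1) - _ * orthoNext m k = 0
      rw [recA_succ, recB_succ_succ]; field_simp; ring

/-- `s² - 2 t` for a polynomial `x ^ k - s x ^ (k - 1) + t x ^ (k - 2) - …`: the sum of the squares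
of its roots. -/
def rootSquareSum (k : ℕ) (p : ℝ[X]) : ℝ :=
  -- The shift by `X ^ 2` gives the coefficients of orders `k - 1` and `k - 2` without truncated
  -- subtraction, so the formula is also right for `k = 0` and `k = 1`.
  (X ^ 2 * p).coeff (k + 1) ^ 2 - 2 * (X ^ 2 * p).coeff k

theorem rootSquareSum_prod {ι : Type*} (s : Finset ι) (x : ι → ℝ) :
    rootSquareSum s.card (∏ i ∈ s, (X - C (x i))) = ∑ i ∈ s, x i ^ 2 := by
  classical
  induction s using Finset.induction_on with
  | empty => simp [rootSquareSum, coeff_X_pow]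
  | insert a s ha ih =>
    have hm : (∏ i ∈ s, (X - C (x i))).coeff s.card = 1 := by
      have := monic_prod_of_monic s (fun i => X - C (x i)) fun i _ => monic_X_sub_C _
      have h2 : (∏ i ∈ s, (X - C (x i))).natDegree = s.card := by
        simp
      rw [Monic, leadingCoeff, h2] at this
      exact this
    rw [Finset.sum_insert ha, ← ih, Finset.prod_insert ha, Finset.card_insert_of_notMem ha]
    set p := ∏ i ∈ s, (X - C (x i))
    have e : X ^ 2 * ((X - C (x a)) * p) = X * (X ^ 2 * p) - C (x a) * (X ^ 2 * p) := by ring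
    have h1 : (X ^ 2 * p).coeff (s.card + 2) = 1 := by
      rw [coeff_X_pow_mul, hm]
    simp only [rootSquareSum, e, coeff_sub, coeff_C_mul, coeff_X_mul, h1]
    ring

/-- One step of the recursion replaces `s` by `s + b` and `t` by `t + b s - a`, which raises `s ^ 2
- 2 t` by `b ^ 2 + 2 a`. -/
theorem rootSquareSum_orthoPoly {N n : ℕ} {m : Fin N → ℝ} (hm : m ∈ posMoments N n) {k : ℕ}
    (hk : k ≤ n) : rootSquareSum k (orthoPoly m k) =
      ∑ j ∈ Finset.Icc 1 k, recB m j ^ 2 + 2 * ∑ j ∈ Finset.Icc 1 (k - 1), recA m j := by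
  have hc : ∀ j ≤ n, (X ^ 2 * orthoPoly m j).coeff (j + 2) = 1 := fun j hj => by
    rw [coeff_X_pow_mul, coeff_orthoPoly_self (hm j hj).ne']
  match k with
  | 0 => simp [rootSquareSum, orthoPoly_zero, coeff_X_pow]
  | k + 1 =>
    induction k with
    | zero =>
      have e : X ^ 2 * orthoPoly m 1 = X * (X ^ 2 * orthoPoly m 0) -
          C (recB m 1) * (X ^ 2 * orthoPoly m 0) := by
        linear_combination - X ^ 2 * X_mul_orthoPoly_zero m
      simp [rootSquareSum, e, orthoPoly_zero, coeff_X_pow]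
    | succ k ih =>
      have e : X ^ 2 * orthoPoly m (k + 2) = X * (X ^ 2 * orthoPoly m (k + 1)) -
          C (recB m (k + 2)) * (X ^ 2 * orthoPoly m (k + 1)) -
          C (recA m (k + 1)) * (X ^ 2 * orthoPoly m k) := by
        linear_combination - X ^ 2 * X_mul_orthoPoly_succ hm hk
      have h0 := hc k (by omega)
      have h1 := hc (k + 1) (by omega)
      have h3 : (X ^ 2 * orthoPoly m k).coeff (k + 3) = 0 := by
        rw [show k + 3 = (k + 1) + 2 by ring, coeff_X_pow_mul]
        exact coeff_eq_zero_of_natDegree_lt ((natDegree_orthoPoly_le m k).trans_lt (by omega))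
      have ih := ih (by omega)
      rw [Finset.sum_Icc_succ_top (b := k + 1) (by omega), show k + 1 + 1 - 1 = k + 1 by omega,
        Finset.sum_Icc_succ_top (f := fun j => recA m j) (b := k) (by omega)]
      simp only [Nat.add_sub_cancel] at ih
      simp only [rootSquareSum] at ih ⊢
      rw [show k + 1 + 1 = k + 2 from rfl, e]
      simp only [coeff_sub, coeff_C_mul, coeff_X_mul]
      rw [show k + 1 + 2 = k + 3 from rfl] at h1
      rw [show k + 1 + 1 = k + 2 from rfl] at ih
      simp only [h0, h1, h3, show k + 2 + 1 = k + 3 from rfl]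
      linear_combination ih

/-! ### Moments of finitely supported measures -/

/-- The moments of orders `1, …, N` of `∑ᵢ wᵢ δ_{xᵢ}`. -/
def nodeMoments {n : ℕ} (N : ℕ) (x w : Fin n → ℝ) : Fin N → ℝ :=
  fun k => ∑ i, w i * x i ^ ((k : ℕ) + 1)

section nodes

variable {n N : ℕ} {x w : Fin n → ℝ}

theorem momentOf_nodeMoments (hw : ∑ i, w i = 1) {j : ℕ} (hj : j ≤ N) :
    momentOf (nodeMoments N x w) j = ∑ i, w i * x i ^ j := by
  cases j with
  | zero => simp [momentOf, hw]
  | succ j => simp [momentOf, nodeMoments, show j < N by omega]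

theorem momentLin_nodeMoments (hw : ∑ i, w i = 1) {p : ℝ[X]} (hp : p.natDegree ≤ N) :
    momentLin (nodeMoments N x w) p = ∑ i, w i * p.eval (x i) := by
  have h := momentLin_X_pow_mul (nodeMoments N x w) 0 _ p (Nat.lt_succ_self _)
  rw [pow_zero, one_mul] at h
  simp only [h, eval_eq_sum_range, Finset.mul_sum]
  rw [Finset.sum_comm]
  refine Finset.sum_congr rfl fun j hj => ?_
  rw [zero_add, momentOf_nodeMoments hw (by simp at hj; omega), Finset.mul_sum]
  exact Finset.sum_congr rfl fun i _ => by ring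

theorem hankelMatrix_nodeMoments (hw : ∑ i, w i = 1) {k : ℕ} (hk : 2 * k ≤ N + 2) :
    (Matrix.of fun i j : Fin k => momentOf (nodeMoments N x w) ((i : ℕ) + (j : ℕ))) =
      (Matrix.of fun (l : Fin n) (i : Fin k) => x l ^ (i : ℕ)).transpose * Matrix.diagonal w *
        Matrix.of fun (l : Fin n) (i : Fin k) => x l ^ (i : ℕ) := by
  ext i j
  rw [Matrix.of_apply, momentOf_nodeMoments hw (by omega), Matrix.mul_apply]
  refine Finset.sum_congr rfl fun l _ => ?_
  rw [Matrix.mul_diagonal, Matrix.transpose_apply, Matrix.of_apply, Matrix.of_apply]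
  ring

theorem hankelDet_nodeMoments (hw : ∑ i, w i = 1) (hn : 2 * n ≤ N + 2) :
    hankelDet (nodeMoments N x w) n = (∏ i, w i) * (Matrix.vandermonde x).det ^ 2 := by
  rw [hankelDet, hankelMatrix_nodeMoments hw hn, Matrix.det_mul, Matrix.det_mul,
    Matrix.det_transpose, Matrix.det_diagonal]
  change (Matrix.vandermonde x).det * _ * (Matrix.vandermonde x).det = _
  ring

/-- `P_k` is monic, so `P_k - x ^ k` has lower degree and is orthogonal to `P_k`. -/
theorem momentLin_orthoPoly_mul_self {N : ℕ} {m : Fin N → ℝ} {k : ℕ} (hk : hankelDet m k ≠ 0) :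
    momentLin m (orthoPoly m k * orthoPoly m k) = orthoNorm m k := by
  cases k with
  | zero => simp [orthoNorm, orthoPoly_zero]
  | succ k =>
    have hd : (orthoPoly m (k + 1) - X ^ (k + 1)).natDegree < k + 1 := by
      rw [Nat.lt_succ_iff, natDegree_le_iff_coeff_eq_zero]
      intro i hi
      rw [coeff_sub, coeff_X_pow]
      split_ifs with h
      · rw [h, coeff_orthoPoly_self hk, sub_self]
      · rw [coeff_eq_zero_of_natDegree_lt, sub_zero]
        exact (natDegree_orthoPoly_le m (k + 1)).trans_lt (by omega)
    have := momentLin_mul_orthoPoly_of_natDegree_lt m hd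
    rw [sub_mul, map_sub, sub_eq_zero] at this
    exact this

theorem exists_eval_ne_zero (hx : Function.Injective x) {p : ℝ[X]} (hp : p ≠ 0)
    (hd : p.natDegree < n) : ∃ i, p.eval (x i) ≠ 0 := by
  by_contra! h
  refine hp (eq_zero_of_natDegree_lt_card_of_eval_eq_zero p hx h ?_)
  simpa using hd

/-- Inductively, `P_k` with `k < n` cannot vanish at all `n` distinct nodes. Hence `∫ P_k ^ 2`, the
ratio of the next Hankel determinant to the current one, is positive. -/
theorem nodeMoments_mem_posMoments (hx : Function.Injective x) (hw0 : ∀ i, 0 < w i)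
    (hw : ∑ i, w i = 1) (hn : 2 * n ≤ N + 2) : nodeMoments N x w ∈ posMoments N n := by
  intro k
  induction k with
  | zero => intro _; simp [hankelDet_zero]
  | succ k ih =>
    intro hk
    have h0 := ih (by omega)
    have hd : (orthoPoly (nodeMoments N x w) k).natDegree = k := natDegree_orthoPoly h0.ne'
    have h1 : 0 < orthoNorm (nodeMoments N x w) k := by
      rw [← momentLin_orthoPoly_mul_self h0.ne', momentLin_nodeMoments hw]
      · obtain ⟨i, hi⟩ := exists_eval_ne_zero hx (monic_orthoPoly h0.ne').ne_zero (by omega)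
        refine Finset.sum_pos' (fun j _ => ?_) ⟨i, Finset.mem_univ _, ?_⟩
        · rw [eval_mul]; exact mul_nonneg (hw0 j).le (mul_self_nonneg _)
        · rw [eval_mul]; exact mul_pos (hw0 i) (mul_self_pos.2 hi)
      · refine natDegree_mul_le.trans ?_
        omega
    rw [orthoNorm_eq] at h1
    exact pos_of_mul_pos_right h1 (inv_pos.2 h0).le

/-- The nodal polynomial is monic of degree `n` and vanishes on the support, so it is orthogonal to
every `x ^ j` with `j < n`. Testing this uses moments up to order `2 n - 1`, whence the bound on
`N`. -/
theorem orthoPoly_nodeMoments (hx : Function.Injective x) (hw0 : ∀ i, 0 < w i)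
    (hw : ∑ i, w i = 1) (hn : 2 * n ≤ N + 1) :
    orthoPoly (nodeMoments N x w) n = ∏ i, (X - C (x i)) := by
  have hpos := nodeMoments_mem_posMoments hx hw0 hw (by omega : 2 * n ≤ N + 2)
  have hD := (hpos n le_rfl).ne'
  have hm : (∏ i, (X - C (x i))).Monic := monic_prod_of_monic _ _ fun i _ => monic_X_sub_C _
  have hdeg : (∏ i, (X - C (x i))).natDegree = n := by simp
  rw [← sub_eq_zero]
  refine eq_zero_of_momentLin_eq_zero hD ?_ fun j hj => ?_
  · have h1 := degree_eq_natDegree (monic_orthoPoly hD).ne_zero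
    have h2 := degree_eq_natDegree hm.ne_zero
    rw [natDegree_orthoPoly hD] at h1
    rw [hdeg] at h2
    have := degree_sub_lt_left (h1.trans h2.symm) (monic_orthoPoly hD).ne_zero
      (by rw [monic_orthoPoly hD, hm])
    rwa [h1] at this
  · rw [mul_sub, map_sub, momentLin_X_pow_mul_orthoPoly_of_lt _ hj, zero_sub, neg_eq_zero,
      momentLin_nodeMoments hw]
    · refine Finset.sum_eq_zero fun i _ => ?_
      rw [eval_mul, eval_prod, Finset.prod_eq_zero (Finset.mem_univ i) (by simp)]
      ring
    · refine natDegree_mul_le.trans ?_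
      rw [natDegree_X_pow, hdeg]; omega

theorem sum_sq_nodes (hx : Function.Injective x) (hw0 : ∀ i, 0 < w i)
    (hw : ∑ i, w i = 1) (hn : 2 * n ≤ N + 1) :
    ∑ i, x i ^ 2 = ∑ j ∈ Finset.Icc 1 n, recB (nodeMoments N x w) j ^ 2 +
      2 * ∑ j ∈ Finset.Icc 1 (n - 1), recA (nodeMoments N x w) j := by
  have hpos := nodeMoments_mem_posMoments hx hw0 hw (by omega : 2 * n ≤ N + 2)
  rw [← rootSquareSum_orthoPoly hpos le_rfl, orthoPoly_nodeMoments hx hw0 hw hn,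
    ← rootSquareSum_prod, Finset.card_univ, Fintype.card_fin]

/-- The moments determine `P_n` and hence the set of its roots; `σ` fixes their order. The weights
then solve a Vandermonde system. -/
theorem nodes_injective {x' w' : Fin n → ℝ} (σ : Equiv.Perm (Fin n))
    (hx : StrictMono (x ∘ σ)) (hx' : StrictMono (x' ∘ σ)) (hw0 : ∀ i, 0 < w i)
    (hw0' : ∀ i, 0 < w' i) (hw : ∑ i, w i = 1) (hw' : ∑ i, w' i = 1) (hn : 2 * n ≤ N + 1)
    (h : nodeMoments N x w = nodeMoments N x' w') : x = x' ∧ w = w' := by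
  have hi : Function.Injective x := (σ.injective_comp x).1 hx.injective
  have hi' : Function.Injective x' := (σ.injective_comp x').1 hx'.injective
  have hp : (∏ i, (X - C (x i))) = ∏ i, (X - C (x' i)) := by
    rw [← orthoPoly_nodeMoments hi hw0 hw hn, ← orthoPoly_nodeMoments hi' hw0' hw' hn, h]
  have hr : ∀ y : ℝ, (∃ i, x i = y) ↔ ∃ i, x' i = y := by
    intro y
    have := congrArg (eval y) hp
    simp only [eval_prod, eval_sub, eval_X, eval_C] at this
    have h1 : ∏ i, (y - x i) = 0 ↔ ∏ i, (y - x' i) = 0 := by rw [this]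
    simpa only [Finset.prod_eq_zero_iff, Finset.mem_univ, true_and, sub_eq_zero,
      eq_comm (a := y)] using h1
  have hxx : x ∘ σ = x' ∘ σ := by
    rw [← StrictMono.range_inj hx hx', σ.surjective.range_comp, σ.surjective.range_comp]
    ext y
    exact hr y
  obtain rfl : x = x' := σ.surjective.injective_comp_right hxx
  refine ⟨rfl, ?_⟩
  rw [← sub_eq_zero]
  refine Matrix.eq_zero_of_forall_pow_sum_mul_pow_eq_zero hi fun i => ?_
  simp only [Pi.sub_apply, sub_mul, Finset.sum_sub_distrib]
  rw [← momentOf_nodeMoments hw (show (i : ℕ) ≤ N by omega),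
    ← momentOf_nodeMoments hw' (show (i : ℕ) ≤ N by omega), h, sub_self]

end nodes

/-! ### Gaussian quadrature -/

theorem momentLin_mul_eq_sum {N n : ℕ} (m : Fin N → ℝ) {p q : ℝ[X]} (hp : p.natDegree < n)
    (hq : q.natDegree < n) : momentLin m (p * q) =
      ∑ i : Fin n, ∑ j : Fin n, p.coeff i * momentOf m ((i : ℕ) + (j : ℕ)) * q.coeff j := by
  conv_lhs => rw [p.as_sum_range' n hp, Finset.sum_mul]
  rw [map_sum, Finset.sum_range]
  refine Finset.sum_congr rfl fun i _ => ?_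
  rw [← C_mul_X_pow_eq_monomial, mul_assoc, momentLin_C_mul, momentLin_X_pow_mul m _ n q hq,
    Finset.sum_range, Finset.mul_sum]
  exact Finset.sum_congr rfl fun j _ => by ring

-- Quadrature by diagonalizing the Jacobi matrix: the nodes are its eigenvalues, and the weights are
-- squares attached to its eigenvectors. The Hankel matrix `H` holds the moments up to order `2 n -
-- 2`, and the shifted matrix `H'` supplies the one of order `2 n - 1`.
open Matrix in
theorem exists_nodeMoments_eq {n : ℕ} (hn : 1 ≤ n) {m : Fin (2 * n - 1) → ℝ}
    (hm : m ∈ posMoments (2 * n - 1) n) : ∃ x w : Fin n → ℝ, Function.Injective x ∧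
      (∀ i, 0 < w i) ∧ ∑ i, w i = 1 ∧ nodeMoments (2 * n - 1) x w = m := by
  set H : Matrix (Fin n) (Fin n) ℝ := of fun i j => momentOf m ((i : ℕ) + (j : ℕ)) with hH
  set H' : Matrix (Fin n) (Fin n) ℝ := of fun i j => momentOf m ((i : ℕ) + (j : ℕ) + 1) with hH'
  -- The rows are the coefficients of the orthonormal polynomials, so that `R H Rᵀ = 1`.
  set R : Matrix (Fin n) (Fin n) ℝ :=
    of fun i j => (orthoPoly m i).coeff j / √(orthoNorm m i) with hR
  have hHt : Hᵀ = H := by ext i j; simp [hH, add_comm]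
  have hHt' : H'ᵀ = H' := by ext i j; simp [hH', add_comm]
  have hnorm : ∀ i : Fin n, 0 < orthoNorm m i := fun i => orthoNorm_pos hm i.2
  have hdeg : ∀ i : Fin n, (orthoPoly m i).natDegree < n := fun i =>
    (natDegree_orthoPoly_le m i).trans_lt i.2
  have h1 : R * H * Rᵀ = 1 := by
    ext i j
    have e : (R * H * Rᵀ) i j =
        momentLin m (orthoPoly m i * orthoPoly m j) / (√(orthoNorm m i) * √(orthoNorm m j)) := by
      rw [momentLin_mul_eq_sum m (hdeg i) (hdeg j), Finset.sum_comm, Matrix.mul_apply,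
        Finset.sum_div]
      refine Finset.sum_congr rfl fun l _ => ?_
      rw [Matrix.mul_apply, Finset.sum_mul, Finset.sum_div]
      refine Finset.sum_congr rfl fun k _ => ?_
      simp only [hR, hH, of_apply, transpose_apply]
      ring
    rw [e]
    rcases lt_trichotomy i j with h | rfl | h
    · rw [momentLin_mul_orthoPoly_of_natDegree_lt m
        ((natDegree_orthoPoly_le m i).trans_lt h), one_apply_ne h.ne, zero_div]
    · rw [momentLin_orthoPoly_mul_self (hm i i.2.le).ne', one_apply_eq,
        Real.mul_self_sqrt (hnorm i).le, div_self (hnorm i).ne']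
    · rw [mul_comm (orthoPoly m i), momentLin_mul_orthoPoly_of_natDegree_lt m
        ((natDegree_orthoPoly_le m j).trans_lt h), one_apply_ne h.ne', zero_div]
  have h2 : Rᵀ * (R * H) = 1 := mul_eq_one_comm.1 h1
  set B : Matrix (Fin n) (Fin n) ℝ := R * H' * Rᵀ with hB
  have hBh : B.IsHermitian := by
    rw [IsHermitian, conjTranspose_eq_transpose_of_trivial, hB, transpose_mul, transpose_mul,
      transpose_transpose, hHt', Matrix.mul_assoc]
  set Q : Matrix (Fin n) (Fin n) ℝ := ↑hBh.eigenvectorUnitary with hQ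
  have hQ1 : Q * Qᵀ = 1 := by
    have := (Matrix.mem_unitaryGroup_iff).1 hBh.eigenvectorUnitary.2
    rwa [star_eq_conjTranspose, conjTranspose_eq_transpose_of_trivial] at this
  have hQ2 : Qᵀ * Q = 1 := mul_eq_one_comm.1 hQ1
  set x := hBh.eigenvalues
  have hsp : B = Q * diagonal x * Qᵀ := by
    have := hBh.spectral_theorem
    rw [Unitary.conjStarAlgAut_apply] at this
    rw [this, star_eq_conjTranspose, conjTranspose_eq_transpose_of_trivial]
    rfl
  set T : Matrix (Fin n) (Fin n) ℝ := Qᵀ * (R * H) with hT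
  have hTt : Tᵀ = H * Rᵀ * Q := by
    rw [hT, transpose_mul, transpose_mul, transpose_transpose, hHt]
  have hTT : Tᵀ * T = H := by
    calc Tᵀ * T = H * Rᵀ * (Q * Qᵀ) * (R * H) := by rw [hTt, hT]; simp only [Matrix.mul_assoc]
      _ = H * (Rᵀ * (R * H)) := by rw [hQ1, Matrix.mul_one]; simp only [Matrix.mul_assoc]
      _ = H := by rw [h2, Matrix.mul_one]
  have hDT : diagonal x * T = Qᵀ * (R * H') := by
    calc diagonal x * T = (Qᵀ * Q) * diagonal x * Qᵀ * (R * H) := by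
          rw [hQ2, Matrix.one_mul, hT]; simp only [Matrix.mul_assoc]
      _ = Qᵀ * B * (R * H) := by rw [hsp]; simp only [Matrix.mul_assoc]
      _ = Qᵀ * (R * H' * (Rᵀ * (R * H))) := by rw [hB]; simp only [Matrix.mul_assoc]
      _ = Qᵀ * (R * H') := by rw [h2, Matrix.mul_one]
  have hTDT : Tᵀ * (diagonal x * T) = H' := by
    have h3 : H * Rᵀ * R = 1 := by
      have := congrArg transpose h2
      rwa [transpose_mul, transpose_mul, transpose_transpose, hHt, transpose_one] at this
    calc Tᵀ * (diagonal x * T) = H * Rᵀ * (Q * Qᵀ) * (R * H') := by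
          rw [hDT, hTt]; simp only [Matrix.mul_assoc]
      _ = (H * Rᵀ * R) * H' := by rw [hQ1, Matrix.mul_one]; simp only [Matrix.mul_assoc]
      _ = H' := by rw [h3, Matrix.one_mul]
  -- Column `j + 1` of `H` is column `j` of `H'`, so moving one column to the right in `T`
  -- multiplies row `l` by `x l`.
  have hcol : ∀ (l : Fin n) (j : ℕ) (hj : j < n), T l ⟨j, hj⟩ = T l ⟨0, hn⟩ * x l ^ j := by
    intro l j
    induction j with
    | zero => intro _; simp
    | succ j ih =>
      intro hj
      have e1 : T l ⟨j + 1, hj⟩ = (diagonal x * T) l ⟨j, by omega⟩ := by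
        have e2 : ∀ b, (R * H) b ⟨j + 1, hj⟩ = (R * H') b ⟨j, by omega⟩ := fun b => by
          rw [Matrix.mul_apply, Matrix.mul_apply]
          exact Finset.sum_congr rfl fun a _ => by simp [hH, hH', add_assoc]
        rw [hDT, hT, Matrix.mul_apply, Matrix.mul_apply]
        exact Finset.sum_congr rfl fun b _ => by rw [e2]
      rw [e1, diagonal_mul, ih (by omega)]
      ring
  set w : Fin n → ℝ := fun l => T l ⟨0, hn⟩ ^ 2
  have hmom : ∀ j, j ≤ 2 * n - 1 → momentOf m j = ∑ l, w l * x l ^ j := by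
    intro j hj
    rcases Nat.lt_or_ge j (2 * n - 1) with h | h
    · obtain ⟨a, b, ha, hb, rfl⟩ : ∃ a b, a < n ∧ b < n ∧ a + b = j :=
        ⟨min j (n - 1), j - min j (n - 1), by omega, by omega, by omega⟩
      have := congrFun (congrFun hTT ⟨a, ha⟩) ⟨b, hb⟩
      rw [Matrix.mul_apply] at this
      simp only [hH, of_apply] at this
      rw [← this]
      refine Finset.sum_congr rfl fun l _ => ?_
      rw [transpose_apply, hcol l a ha, hcol l b hb]
      ring
    · obtain rfl : j = (n - 1) + (n - 1) + 1 := by omega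
      have := congrFun (congrFun hTDT ⟨n - 1, by omega⟩) ⟨n - 1, by omega⟩
      rw [Matrix.mul_apply] at this
      simp only [hH', of_apply] at this
      rw [← this]
      refine Finset.sum_congr rfl fun l _ => ?_
      rw [transpose_apply, diagonal_mul, hcol l (n - 1) (by omega)]
      ring
  have hw : ∑ l, w l = 1 := by
    have := hmom 0 (by omega)
    simpa [momentOf] using this.symm
  have hmm : nodeMoments (2 * n - 1) x w = m := by
    funext k
    have := hmom (k + 1) (by omega)
    rw [nodeMoments, ← this]
    simp [momentOf]
  -- The determinant equals `∏ w · Δ ^ 2`. Its positivity makes the nodes distinct and the weights,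
  -- already squares, nonzero.
  have hD := hm n le_rfl
  rw [← hmm, hankelDet_nodeMoments hw (by omega)] at hD
  refine ⟨x, w, ?_, fun i => ?_, hw, hmm⟩
  · rw [← det_vandermonde_ne_zero_iff]
    intro h0
    simp [h0] at hD
  · refine lt_of_le_of_ne (sq_nonneg _) fun h0 => ?_
    rw [Finset.prod_eq_zero (Finset.mem_univ i) h0.symm, zero_mul] at hD
    exact lt_irrefl _ hD

theorem nodeMoments_comp_perm {n N : ℕ} (σ : Equiv.Perm (Fin n)) (x w : Fin n → ℝ) :
    nodeMoments N (x ∘ σ) (w ∘ σ) = nodeMoments N x w := by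
  funext k
  exact Equiv.sum_comp σ fun i => w i * x i ^ ((k : ℕ) + 1)

theorem exists_nodeMoments_eq_of_perm {n : ℕ} (hn : 1 ≤ n) (σ : Equiv.Perm (Fin n))
    {m : Fin (2 * n - 1) → ℝ} (hm : m ∈ posMoments (2 * n - 1) n) :
    ∃ x w : Fin n → ℝ, StrictMono (x ∘ σ) ∧ (∀ i, 0 < w i) ∧ ∑ i, w i = 1 ∧
      nodeMoments (2 * n - 1) x w = m := by
  obtain ⟨x, w, hx, hw0, hw, rfl⟩ := exists_nodeMoments_eq hn hm
  set τ : Equiv.Perm (Fin n) := σ.symm.trans (Tuple.sort x) with hτ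
  refine ⟨x ∘ τ, w ∘ τ, ?_, fun i => hw0 _, ?_, nodeMoments_comp_perm τ x w⟩
  · have h : (x ∘ τ) ∘ σ = x ∘ Tuple.sort x := by funext i; simp [hτ]
    rw [h]
    exact (Tuple.monotone_sort x).strictMono_of_injective (hx.comp (Tuple.sort x).injective)
  · rw [← hw]
    exact Equiv.sum_comp τ w

/-! ### Reindexing -/

/-- `Fin (n - 1) ⊕ Fin n ≃ Fin (2 n - 1)`: the weights come first, then the nodes. -/
def sumIndexEquiv (n : ℕ) : Fin (n - 1) ⊕ Fin n ≃ Fin (2 * n - 1) :=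
  finSumFinEquiv.trans (finCongr (by omega))

theorem sumIndexEquiv_inl (n : ℕ) (j : Fin (n - 1)) : (sumIndexEquiv n (.inl j) : ℕ) = j := rfl

theorem sumIndexEquiv_inr (n : ℕ) (j : Fin n) :
    (sumIndexEquiv n (.inr j) : ℕ) = n - 1 + j := rfl

/-! ### Determinants -/

/-- Modulo constants, which every `φ c` kills, passing from the powers to monic polynomials of the
same degrees is a unipotent triangular change of basis. -/
theorem det_monic_eq_det_X_pow {N : ℕ} (p : Fin N → ℝ[X]) (hp : ∀ k, (p k).Monic)
    (hd : ∀ k : Fin N, (p k).natDegree = (k : ℕ) + 1) (φ : Fin N → ℝ[X] →ₗ[ℝ] ℝ)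
    (hφ : ∀ c, φ c 1 = 0) :
    (Matrix.of fun k c => φ c (p k)).det =
      (Matrix.of fun k c : Fin N => φ c (X ^ ((k : ℕ) + 1))).det := by
  set L : Matrix (Fin N) (Fin N) ℝ := Matrix.of fun k l => (p k).coeff ((l : ℕ) + 1) with hL
  have e : (Matrix.of fun k c => φ c (p k)) =
      L * Matrix.of fun k c : Fin N => φ c (X ^ ((k : ℕ) + 1)) := by
    ext k c
    rw [Matrix.of_apply, Matrix.mul_apply]
    conv_lhs => rw [(p k).as_sum_range' (N + 1) (by rw [hd]; omega)]
    rw [Finset.sum_range_succ', map_add, map_sum, Finset.sum_range]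
    have h0 : φ c (monomial 0 ((p k).coeff 0)) = 0 := by
      rw [← C_mul_X_pow_eq_monomial, pow_zero, ← smul_eq_C_mul, map_smul, hφ, smul_zero]
    rw [h0, add_zero]
    refine Finset.sum_congr rfl fun l _ => ?_
    rw [← C_mul_X_pow_eq_monomial, ← smul_eq_C_mul, map_smul, smul_eq_mul]
    rfl
  rw [e, Matrix.det_mul, Matrix.det_of_isLowerTriangular L, Finset.prod_eq_one, one_mul]
  · intro k _
    have := hp k
    rw [Monic, leadingCoeff, hd] at this
    exact this
  · intro k l hkl
    have hkl : k < l := hkl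
    exact coeff_eq_zero_of_natDegree_lt (by rw [hd]; omega)

theorem abs_det_vandermonde_castSucc {p : ℕ} (x : Fin (p + 1) → ℝ) :
    |(Matrix.vandermonde x).det| = |(Matrix.vandermonde (x ∘ Fin.castSucc)).det| *
      |∏ j : Fin p, (x j.castSucc - x (Fin.last p))| := by
  have h : ∀ (q : ℕ) (f : Fin q → Fin q → ℝ), ∏ i, ∏ j ∈ Finset.Ioi i, f i j =
      ∏ i, ∏ j, if i < j then f i j else 1 := fun q f => by
    refine Finset.prod_congr rfl fun i _ => ?_
    rw [← Finset.prod_filter, Finset.filter_lt_eq_Ioi]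
  rw [Matrix.det_vandermonde, Matrix.det_vandermonde, h, h, Fin.prod_univ_castSucc]
  simp only [Fin.prod_univ_castSucc (fun j => ite _ _ _), Fin.castSucc_lt_castSucc_iff,
    Fin.castSucc_lt_last, if_true, Finset.prod_mul_distrib, Function.comp_apply]
  rw [abs_mul, abs_mul]
  have h1 : ∏ j : Fin p, |x (Fin.last p) - x j.castSucc| =
      ∏ j : Fin p, |x j.castSucc - x (Fin.last p)| :=
    Finset.prod_congr rfl fun j _ => abs_sub_comm _ _
  rw [Finset.abs_prod Finset.univ (fun i : Fin p => x (Fin.last p) - x i.castSucc),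
    Finset.abs_prod Finset.univ (fun i : Fin p => x i.castSucc - x (Fin.last p)), h1]
  simp [Fin.not_lt.2 (Fin.le_last _)]

theorem eval_derivative_prod_X_sub_C {n : ℕ} (x : Fin n → ℝ) (i : Fin n) :
    (derivative (∏ j, (X - C (x j)))).eval (x i) = ∏ j ∈ {i}ᶜ, (x i - x j) := by
  rw [← Finset.mul_prod_erase _ _ (Finset.mem_univ i), derivative_mul]
  simp [eval_prod, Finset.compl_singleton]

theorem abs_prod_eval_derivative {n : ℕ} (x : Fin n → ℝ) :
    |∏ i, (derivative (∏ j, (X - C (x j)))).eval (x i)| = (Matrix.vandermonde x).det ^ 2 := by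
  simp only [eval_derivative_prod_X_sub_C, Finset.abs_prod]
  rw [← sq_abs, Matrix.det_vandermonde]
  simp only [Finset.abs_prod]
  have := Finset.prod_prod_Ioi_mul_eq_prod_prod_off_diag fun i j => |x j - x i|
  rw [← this, sq, ← Finset.prod_mul_distrib]
  refine Finset.prod_congr rfl fun i _ => ?_
  rw [← Finset.prod_mul_distrib]
  exact Finset.prod_congr rfl fun j _ => by rw [abs_sub_comm (x i) (x j)]

/-- The partial derivatives of the moments of `∑ᵢ wᵢ δ_{xᵢ}` with respect to a weight (the last
weight being `1` minus the sum of the others) or a node, as functionals on polynomials. -/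
def nodeFunctional {p : ℕ} (x w : Fin (p + 1) → ℝ) : Fin p ⊕ Fin (p + 1) → ℝ[X] →ₗ[ℝ] ℝ
  | .inl j => leval (x j.castSucc) - leval (x (Fin.last p))
  | .inr i => w i • (leval (x i) ∘ₗ derivative)

/-- The powers are replaced by `(X - x_last) X ^ j` followed by `P X ^ i`, where `P` is the nodal
polynomial. Multiples of `P` vanish at the nodes, so the matrix is block triangular. The weight
block contributes `|Δ|`; the node block contributes `|Δ|` times `∏ w_i P'(x_i)`, and `|∏ P'(x_i)| =
Δ ^ 2`. -/
theorem abs_det_nodeFunctional {p : ℕ} (x w : Fin (p + 1) → ℝ) :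
    |(Matrix.of fun k c : Fin (2 * (p + 1) - 1) =>
      nodeFunctional x w ((sumIndexEquiv (p + 1)).symm c) (X ^ ((k : ℕ) + 1))).det| =
      |∏ i, w i| * (Matrix.vandermonde x).det ^ 4 := by
  set e : Fin p ⊕ Fin (p + 1) ≃ Fin (2 * (p + 1) - 1) := sumIndexEquiv (p + 1)
  set P : ℝ[X] := ∏ j, (X - C (x j)) with hP
  have hPm : P.Monic := monic_prod_of_monic _ _ fun i _ => monic_X_sub_C _
  have hPd : P.natDegree = p + 1 := by simp [hP]
  have hPe : ∀ i, P.eval (x i) = 0 := fun i => by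
    rw [hP, eval_prod, Finset.prod_eq_zero (Finset.mem_univ i) (by simp)]
  set q : Fin p ⊕ Fin (p + 1) → ℝ[X] := fun s => s.elim
    (fun j : Fin p => (X - C (x (Fin.last p))) * X ^ (j : ℕ))
    (fun i : Fin (p + 1) => P * X ^ (i : ℕ)) with hq
  have hqm : ∀ s, (q s).Monic := by
    rintro (j | i)
    · exact (monic_X_sub_C _).mul (monic_X_pow _)
    · exact hPm.mul (monic_X_pow _)
  have hqd : ∀ s, (q s).natDegree = (e s : ℕ) + 1 := by
    rintro (j | i)
    · rw [sumIndexEquiv_inl]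
      simp only [hq, Sum.elim_inl]
      rw [(monic_X_sub_C _).natDegree_mul (monic_X_pow _), natDegree_X_sub_C, natDegree_X_pow,
        add_comm]
    · rw [sumIndexEquiv_inr]
      simp only [hq, Sum.elim_inr]
      rw [hPm.natDegree_mul (monic_X_pow _), hPd, natDegree_X_pow]
      omega
  rw [← det_monic_eq_det_X_pow (fun k => q (e.symm k)) (fun k => hqm _)
    (fun k => by rw [hqd, e.apply_symm_apply]) (fun c => nodeFunctional x w (e.symm c))]
  · rw [← Matrix.det_submatrix_equiv_self e]
    have hblock : (Matrix.of fun k c => nodeFunctional x w (e.symm c) (q (e.symm k))).submatrix e e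
        = Matrix.fromBlocks
          ((Matrix.vandermonde (x ∘ Fin.castSucc)).transpose *
            Matrix.diagonal fun j : Fin p => x j.castSucc - x (Fin.last p))
          (Matrix.of fun j i => nodeFunctional x w (.inr i) (q (.inl j))) 0
          ((Matrix.vandermonde x).transpose *
            Matrix.diagonal fun i => w i * (derivative P).eval (x i)) := by
      ext (j | i) (j' | i')
      · simp [nodeFunctional, hq, Matrix.mul_diagonal, Matrix.vandermonde_apply, mul_comm]
      · simp
      · simp [nodeFunctional, hq, hPe]
      · simp [nodeFunctional, hq, hPe, Matrix.mul_diagonal, Matrix.vandermonde_apply,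
          derivative_mul]
        ring
    rw [hblock, Matrix.det_fromBlocks_zero₂₁, Matrix.det_mul, Matrix.det_mul,
      Matrix.det_transpose, Matrix.det_transpose, Matrix.det_diagonal, Matrix.det_diagonal,
      Finset.prod_mul_distrib, abs_mul, abs_mul, ← abs_det_vandermonde_castSucc, abs_mul, abs_mul,
      abs_prod_eval_derivative]
    have := sq_abs (Matrix.vandermonde x).det
    calc _ = |∏ i, w i| * (|(Matrix.vandermonde x).det| ^ 2 * (Matrix.vandermonde x).det ^ 2) := by
          ring
      _ = _ := by rw [this]; ring
  · intro c
    rcases e.symm c with j | i <;> simp [nodeFunctional]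

/-! ### The moment map in the coordinates given by weights and nodes -/

theorem completeWeights_castSucc {p : ℕ} (v : Fin (p + 1 - 1) → ℝ) (j : Fin p) :
    completeWeights (p + 1) v j.castSucc = v j := by
  simp [completeWeights]

theorem completeWeights_last {p : ℕ} (v : Fin (p + 1 - 1) → ℝ) :
    completeWeights (p + 1) v (Fin.last p) = 1 - ∑ j, v j := by
  simp [completeWeights]

theorem sum_completeWeights {n : ℕ} (hn : 1 ≤ n) (v : Fin (n - 1) → ℝ) :
    ∑ i, completeWeights n v i = 1 := by
  obtain ⟨p, rfl⟩ : ∃ p, n = p + 1 := ⟨n - 1, by omega⟩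
  rw [Fin.sum_univ_castSucc, completeWeights_last]
  simp only [completeWeights_castSucc]
  exact add_sub_cancel _ _

theorem completeWeights_injective {n : ℕ} : Function.Injective (completeWeights n) := by
  intro v v' h
  funext j
  have := congrFun h ⟨j, by omega⟩
  simpa [completeWeights] using this

theorem exists_completeWeights_eq {n : ℕ} (hn : 1 ≤ n) {w : Fin n → ℝ} (hw : ∑ i, w i = 1) :
    ∃ v, completeWeights n v = w := by
  obtain ⟨p, rfl⟩ : ∃ p, n = p + 1 := ⟨n - 1, by omega⟩
  refine ⟨fun j : Fin p => w j.castSucc, ?_⟩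
  rw [Fin.sum_univ_castSucc] at hw
  funext i
  refine Fin.lastCases ?_ (fun j => ?_) i
  · rw [completeWeights_last]
    exact (eq_sub_of_add_eq' hw).symm
  · rw [completeWeights_castSucc]

theorem continuous_completeWeights (n : ℕ) : Continuous (completeWeights n) := by
  refine continuous_pi fun i => ?_
  unfold completeWeights
  split_ifs <;> fun_prop

/-- The nodes of a point of `ℝ ^ (2 n - 1)`. -/
def nodesOf (n : ℕ) (y : Fin (2 * n - 1) → ℝ) : Fin n → ℝ :=
  fun i => y (sumIndexEquiv n (.inr i))

/-- The weights of a point of `ℝ ^ (2 n - 1)`. -/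
def weightsOf (n : ℕ) (y : Fin (2 * n - 1) → ℝ) : Fin n → ℝ :=
  completeWeights n fun j => y (sumIndexEquiv n (.inl j))

/-- The moments of the discrete measure with the nodes and weights of `y`. -/
def spectralMoments (n : ℕ) (y : Fin (2 * n - 1) → ℝ) : Fin (2 * n - 1) → ℝ :=
  nodeMoments (2 * n - 1) (nodesOf n y) (weightsOf n y)

theorem continuous_nodesOf (n : ℕ) : Continuous (nodesOf n) :=
  continuous_pi fun _ => continuous_apply _

theorem continuous_weightsOf (n : ℕ) : Continuous (weightsOf n) :=
  (continuous_completeWeights n).comp (continuous_pi fun _ => continuous_apply _)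

theorem continuous_spectralMoments (n : ℕ) : Continuous (spectralMoments n) := by
  have hw : ∀ i, Continuous fun y => weightsOf n y i := fun i =>
    (continuous_apply i).comp (continuous_weightsOf n)
  have hx : ∀ i, Continuous fun y => nodesOf n y i := fun i =>
    (continuous_apply i).comp (continuous_nodesOf n)
  unfold spectralMoments nodeMoments
  fun_prop

theorem eq_of_nodesOf_eq_of_weightsOf_eq {n : ℕ} {y y' : Fin (2 * n - 1) → ℝ}
    (h : nodesOf n y = nodesOf n y') (h' : weightsOf n y = weightsOf n y') : y = y' := by
  have h2 := completeWeights_injective h'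
  funext k
  obtain ⟨s, rfl⟩ := (sumIndexEquiv n).surjective k
  rcases s with j | i
  · exact congrFun h2 j
  · exact congrFun h i

theorem exists_nodesOf_eq_weightsOf_eq {n : ℕ} (hn : 1 ≤ n) (x : Fin n → ℝ) {w : Fin n → ℝ}
    (hw : ∑ i, w i = 1) : ∃ y, nodesOf n y = x ∧ weightsOf n y = w := by
  obtain ⟨v, rfl⟩ := exists_completeWeights_eq hn hw
  refine ⟨fun k => Sum.elim v x ((sumIndexEquiv n).symm k), ?_, ?_⟩
  · funext i; simp [nodesOf]
  · simp [weightsOf]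

theorem exists_hasFDerivAt_spectralMoments {n : ℕ} (hn : 1 ≤ n) (y : Fin (2 * n - 1) → ℝ) :
    ∃ f' : (Fin (2 * n - 1) → ℝ) →L[ℝ] (Fin (2 * n - 1) → ℝ),
      HasFDerivAt (spectralMoments n) f' y ∧
      |f'.det| = |∏ i, weightsOf n y i| * (Matrix.vandermonde (nodesOf n y)).det ^ 4 := by
  obtain ⟨p, rfl⟩ : ∃ p, n = p + 1 := ⟨n - 1, by omega⟩
  set x := nodesOf (p + 1) y with hx
  set w := weightsOf (p + 1) y with hw
  set e : Fin p ⊕ Fin (p + 1) ≃ Fin (2 * (p + 1) - 1) := sumIndexEquiv (p + 1) with he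
  set J : Matrix (Fin (2 * (p + 1) - 1)) (Fin (2 * (p + 1) - 1)) ℝ :=
    Matrix.of fun k c => nodeFunctional x w (e.symm c) (X ^ ((k : ℕ) + 1)) with hJ
  refine ⟨LinearMap.toContinuousLinearMap (Matrix.toLin' J), ?_, ?_⟩
  · rw [hasFDerivAt_pi']
    intro k
    have hX : ∀ i, HasFDerivAt (fun z : Fin (2 * (p + 1) - 1) → ℝ => nodesOf (p + 1) z i)
        (ContinuousLinearMap.proj (R := ℝ) (φ := fun _ => ℝ) (e (.inr i))) y := fun i => hasFDerivAt_apply _ _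
    have hV : ∀ j : Fin p, HasFDerivAt (fun z : Fin (2 * (p + 1) - 1) → ℝ => z (e (.inl j)))
        (ContinuousLinearMap.proj (R := ℝ) (φ := fun _ => ℝ) (e (.inl j))) y := fun i => hasFDerivAt_apply _ _
    -- The dependent last weight is written out, since it produces the subtracted evaluation at the
    -- last node in the weight derivatives.
    have hf : (fun z => spectralMoments (p + 1) z k) = fun z : Fin (2 * (p + 1) - 1) → ℝ =>
        ∑ j : Fin p, z (e (.inl j)) * nodesOf (p + 1) z j.castSucc ^ ((k : ℕ) + 1) +
        (1 - ∑ j : Fin p, z (e (.inl j))) * nodesOf (p + 1) z (Fin.last p) ^ ((k : ℕ) + 1) := by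
      funext z
      rw [spectralMoments, nodeMoments, Fin.sum_univ_castSucc, weightsOf, completeWeights_last]
      simp only [completeWeights_castSucc]
      rfl
    rw [hf]
    have hD := (HasFDerivAt.fun_sum fun (j : Fin p) (_ : j ∈ Finset.univ) =>
      (hV j).fun_mul ((hX j.castSucc).pow ((k : ℕ) + 1))).fun_add
        (((HasFDerivAt.fun_sum fun (j : Fin p) (_ : j ∈ Finset.univ) => hV j).const_sub 1).fun_mul
          ((hX (Fin.last p)).pow ((k : ℕ) + 1)))
    refine hD.congr_fderiv ?_
    ext z
    have hwc : ∀ j : Fin p, w j.castSucc = y (e (.inl j)) := fun j => completeWeights_castSucc _ _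
    have hwl : w (Fin.last p) = 1 - ∑ j : Fin p, y (e (.inl j)) := completeWeights_last _
    have hR : (Matrix.toLin' J) z k = ∑ j : Fin p, (x j.castSucc ^ ((k : ℕ) + 1) -
        x (Fin.last p) ^ ((k : ℕ) + 1)) * z (e (.inl j)) +
        ∑ i, w i * (((k : ℕ) + 1) * x i ^ (k : ℕ)) * z (e (.inr i)) := by
      rw [Matrix.toLin'_apply, Matrix.mulVec, dotProduct, ← Equiv.sum_comp e,
        Fintype.sum_sum_type]
      simp [hJ, nodeFunctional]
    simp only [ContinuousLinearMap.comp_apply, LinearMap.coe_toContinuousLinearMap',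
      ContinuousLinearMap.proj_apply, hR]
    rw [Fin.sum_univ_castSucc (n := p), hwl]
    simp only [hwc, add_apply, sum_apply,
      smul_apply, ContinuousLinearMap.proj_apply, smul_eq_mul,
      neg_apply, nsmul_eq_mul, Nat.cast_add, Nat.cast_one, ← hx,
      add_tsub_cancel_right]
    simp only [sub_mul, Finset.sum_sub_distrib, ← Finset.mul_sum, Finset.sum_add_distrib]
    have h1 : ∀ j : Fin p, y (e (.inl j)) * (((k : ℕ) + 1) * x j.castSucc ^ (k : ℕ) *
        z (e (.inr j.castSucc))) = y (e (.inl j)) * (((k : ℕ) + 1) * x j.castSucc ^ (k : ℕ)) *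
        z (e (.inr j.castSucc)) := fun j => by ring
    simp only [h1]
    ring
  · rw [ContinuousLinearMap.det, LinearMap.coe_toContinuousLinearMap, LinearMap.det_toLin']
    exact abs_det_nodeFunctional x w

/-- The points with positive weights whose nodes are in the order given by `σ`. -/
def chamber (n : ℕ) (σ : Equiv.Perm (Fin n)) : Set (Fin (2 * n - 1) → ℝ) :=
  {y | StrictMono (nodesOf n y ∘ σ) ∧ ∀ i, 0 < weightsOf n y i}

theorem measurableSet_chamber (n : ℕ) (σ : Equiv.Perm (Fin n)) :
    MeasurableSet (chamber n σ) := by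
  have hx : ∀ i, Measurable fun y => nodesOf n y i := fun i =>
    ((continuous_apply i).comp (continuous_nodesOf n)).measurable
  have hw : ∀ i, Measurable fun y => weightsOf n y i := fun i =>
    ((continuous_apply i).comp (continuous_weightsOf n)).measurable
  have : chamber n σ = (⋂ i, ⋂ j, ⋂ _ : i < j, {y | nodesOf n y (σ i) < nodesOf n y (σ j)}) ∩
      ⋂ i, {y | 0 < weightsOf n y i} := by
    ext y; simp [chamber, StrictMono]
  rw [this]
  refine MeasurableSet.inter ?_ ?_
  · exact MeasurableSet.iInter fun i => MeasurableSet.iInter fun j => MeasurableSet.iInter fun _ =>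
      measurableSet_lt (hx _) (hx _)
  · exact MeasurableSet.iInter fun i => measurableSet_lt measurable_const (hw _)

theorem injOn_spectralMoments {n : ℕ} (hn : 1 ≤ n) (σ : Equiv.Perm (Fin n)) :
    Set.InjOn (spectralMoments n) (chamber n σ) := by
  intro y hy y' hy' h
  obtain ⟨h1, h2⟩ := nodes_injective σ hy.1 hy'.1 hy.2 hy'.2 (sum_completeWeights hn _)
    (sum_completeWeights hn _) (by omega) h
  exact eq_of_nodesOf_eq_of_weightsOf_eq h1 h2

theorem injective_of_mem_chamber {n : ℕ} {σ : Equiv.Perm (Fin n)} {y : Fin (2 * n - 1) → ℝ}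
    (hy : y ∈ chamber n σ) : Function.Injective (nodesOf n y) :=
  (σ.injective_comp _).1 hy.1.injective

theorem image_spectralMoments {n : ℕ} (hn : 1 ≤ n) (σ : Equiv.Perm (Fin n)) :
    spectralMoments n '' chamber n σ = posMoments (2 * n - 1) n := by
  ext m
  constructor
  · rintro ⟨y, hy, rfl⟩
    exact nodeMoments_mem_posMoments (injective_of_mem_chamber hy) hy.2
      (sum_completeWeights hn _) (by omega)
  · intro hm
    obtain ⟨x, w, hx, hw0, hw, rfl⟩ := exists_nodeMoments_eq_of_perm hn σ hm
    obtain ⟨y, rfl, rfl⟩ := exists_nodesOf_eq_weightsOf_eq hn x hw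
    exact ⟨y, ⟨hx, hw0⟩, rfl⟩

/-- Change of variables on one chamber, where the moment map is a bijection onto `posMoments`. The
right-hand side does not depend on `σ`. -/
theorem lintegral_chamber {n : ℕ} (hn : 1 ≤ n) (σ : Equiv.Perm (Fin n))
    (g : (Fin (2 * n - 1) → ℝ) → ℝ≥0∞) :
    ∫⁻ y in chamber n σ, ENNReal.ofReal (|∏ i, weightsOf n y i| *
      (Matrix.vandermonde (nodesOf n y)).det ^ 4) * g (spectralMoments n y) =
      ∫⁻ m in posMoments (2 * n - 1) n, g m := by
  choose f' hf' hdet using exists_hasFDerivAt_spectralMoments hn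
  rw [← image_spectralMoments hn σ, lintegral_image_eq_lintegral_abs_det_fderiv_mul volume
    (measurableSet_chamber n σ) (fun y _ => (hf' y).hasFDerivWithinAt)
    (injOn_spectralMoments hn σ)]
  simp only [hdet]

/-! ### The recursion coefficients as coordinates -/

theorem differentiable_momentOf {N : ℕ} (j : ℕ) :
    Differentiable ℝ fun m : Fin N → ℝ => momentOf m j := by
  cases j with
  | zero => exact differentiable_const _
  | succ j =>
    simp only [momentOf]
    split_ifs
    · exact differentiable_apply _
    · exact differentiable_const _

theorem differentiable_matrix_det {E : Type*} [NormedAddCommGroup E] [NormedSpace ℝ E] {k : ℕ}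
    {A : E → Matrix (Fin k) (Fin k) ℝ} (hA : ∀ i j, Differentiable ℝ fun m => A m i j) :
    Differentiable ℝ fun m => (A m).det := by
  simp only [Matrix.det_apply]
  fun_prop

theorem differentiable_hankelDet {N : ℕ} (k : ℕ) :
    Differentiable ℝ fun m : Fin N → ℝ => hankelDet m k :=
  differentiable_matrix_det fun _ _ => differentiable_momentOf _

theorem measurableSet_posMoments (N n : ℕ) : MeasurableSet (posMoments N n) := by
  have : posMoments N n = ⋂ k, ⋂ _ : k ≤ n, {m | 0 < hankelDet m k} := by
    ext m; simp [posMoments]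
  rw [this]
  exact MeasurableSet.iInter fun k => MeasurableSet.iInter fun _ =>
    measurableSet_lt measurable_const (differentiable_hankelDet k).continuous.measurable

theorem differentiableAt_orthoNorm {N : ℕ} {m : Fin N → ℝ} {k : ℕ} (h : hankelDet m k ≠ 0) :
    DifferentiableAt ℝ (fun m : Fin N → ℝ => orthoNorm m k) m := by
  simp only [orthoNorm_eq]
  exact ((differentiable_hankelDet k m).fun_inv h).fun_mul (differentiable_hankelDet (k + 1) m)

theorem differentiableAt_orthoNext {N : ℕ} {m : Fin N → ℝ} {k : ℕ} (h : hankelDet m k ≠ 0) :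
    DifferentiableAt ℝ (fun m : Fin N → ℝ => orthoNext m k) m := by
  simp only [orthoNext, momentLin_X_pow_mul_orthoPoly]
  refine ((differentiable_hankelDet k m).fun_inv h).fun_mul (differentiable_matrix_det ?_ m)
  intro i j
  simp only [Matrix.of_apply]
  split_ifs <;> exact differentiable_momentOf _

/-- The recursion coefficients in the order `b_1, a_1, b_2, a_2, …, b_n`. -/
def recCoord {N : ℕ} (m : Fin N → ℝ) : Fin N → ℝ :=
  fun i => if (i : ℕ) % 2 = 0 then recB m ((i : ℕ) / 2 + 1) else recA m ((i : ℕ) / 2 + 1)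

theorem differentiableAt_recCoord {n : ℕ} {m : Fin (2 * n - 1) → ℝ}
    (hm : m ∈ posMoments (2 * n - 1) n) :
    DifferentiableAt ℝ (recCoord : (Fin (2 * n - 1) → ℝ) → _) m := by
  have hN : ∀ k, k < n → DifferentiableAt ℝ (fun m : Fin (2 * n - 1) → ℝ => orthoNorm m k) m :=
    fun k hk => differentiableAt_orthoNorm (hm k hk.le).ne'
  have hX : ∀ k, k < n → DifferentiableAt ℝ (fun m : Fin (2 * n - 1) → ℝ => orthoNext m k) m :=
    fun k hk => differentiableAt_orthoNext (hm k hk.le).ne'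
  have h0 : ∀ k, k < n → orthoNorm m k ≠ 0 := fun k hk => (orthoNorm_pos hm hk).ne'
  rw [differentiableAt_pi]
  intro i
  unfold recCoord
  split_ifs with h
  · rcases hk : (i : ℕ) / 2 with _ | k
    · simp only [zero_add, recB_one]
      exact hX 0 (by omega)
    · simp only [recB_succ_succ, div_eq_mul_inv]
      have hk1 : k + 1 < n := by omega
      have hk0 : k < n := by omega
      exact ((hX _ hk1).fun_mul ((hN _ hk1).fun_inv (h0 _ hk1))).fun_sub
        ((hX _ hk0).fun_mul ((hN _ hk0).fun_inv (h0 _ hk0)))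
  · simp only [recA_succ, div_eq_mul_inv]
    have hi1 : (i : ℕ) / 2 + 1 < n := by omega
    have hi0 : (i : ℕ) / 2 < n := by omega
    exact (hN _ hi1).fun_mul ((hN _ hi0).fun_inv (h0 _ hi0))

theorem momentOf_update_of_le {N : ℕ} (m : Fin N → ℝ) (i : Fin N) (t : ℝ) {j : ℕ}
    (hj : j ≤ i) : momentOf (Function.update m i t) j = momentOf m j := by
  cases j with
  | zero => rfl
  | succ j =>
    simp only [momentOf]
    split_ifs with h
    · rw [Function.update_of_ne]
      intro h'
      rw [← h'] at hj
      simp at hj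
    · rfl

theorem momentOf_update_self {N : ℕ} (m : Fin N → ℝ) (i : Fin N) (t : ℝ) :
    momentOf (Function.update m i t) (i + 1) = t := by
  simp [momentOf]

theorem recCoord_update_of_lt {N : ℕ} (m : Fin N → ℝ) {i j : Fin N} (t : ℝ) (h : i < j) :
    recCoord (Function.update m j t) i = recCoord m i := by
  have h : (i : ℕ) < j := h
  unfold recCoord
  split_ifs with hi
  · exact recB_congr fun l hl => momentOf_update_of_le m j t (by omega)
  · exact recA_congr fun l hl => momentOf_update_of_le m j t (by omega)

/-- `P_k` involves only moments of order below `2 k`, so the moment of order `2 k` enters the norm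
once, with the leading coefficient one. -/
theorem orthoNorm_update {N : ℕ} (m : Fin N → ℝ) {i : Fin N} (t : ℝ) {k : ℕ}
    (hi : (i : ℕ) + 1 = 2 * k) (hk : hankelDet m k ≠ 0) :
    orthoNorm (Function.update m i t) k = orthoNorm m k + (t - m i) := by
  rw [orthoNorm_eq_sum, orthoNorm_eq_sum, orthoPoly_congr (k := k) fun j hj =>
    momentOf_update_of_le m i t (by omega), Finset.sum_range_succ, Finset.sum_range_succ,
    Finset.sum_congr rfl fun j hj => by
      rw [momentOf_update_of_le m i t (by simp at hj; omega : k + j ≤ i)],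
    coeff_orthoPoly_self hk, ← two_mul, ← hi, momentOf_update_self]
  have : momentOf m (i + 1) = m i := by simp [momentOf]
  rw [this]; ring

theorem orthoNext_update {N : ℕ} (m : Fin N → ℝ) {i : Fin N} (t : ℝ) {k : ℕ}
    (hi : (i : ℕ) = 2 * k) (hk : hankelDet m k ≠ 0) :
    orthoNext (Function.update m i t) k = orthoNext m k + (t - m i) := by
  rw [orthoNext_eq_sum, orthoNext_eq_sum, orthoPoly_congr (k := k) fun j hj =>
    momentOf_update_of_le m i t (by omega), Finset.sum_range_succ, Finset.sum_range_succ,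
    Finset.sum_congr rfl fun j hj => by
      rw [momentOf_update_of_le m i t (by simp at hj; omega : k + 1 + j ≤ i)],
    coeff_orthoPoly_self hk, show k + 1 + k = (i : ℕ) + 1 by omega, momentOf_update_self]
  have : momentOf m (i + 1) = m i := by simp [momentOf]
  rw [this]; ring

/-- Each coefficient is affine in the newest moment, with nonzero slope. This gives the diagonal of
the derivative as well as injectivity and surjectivity, one moment at a time. -/
theorem recCoord_update_self {N : ℕ} (m : Fin N → ℝ) (i : Fin N) (t : ℝ)
    (hm : m ∈ posMoments N ((i : ℕ) / 2 + 1)) :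
    recCoord (Function.update m i t) i =
      recCoord m i + (t - m i) * (orthoNorm m ((i : ℕ) / 2))⁻¹ := by
  have hD : ∀ k ≤ (i : ℕ) / 2 + 1, hankelDet m k ≠ 0 := fun k hk => (hm k hk).ne'
  have hc : ∀ k : ℕ, 2 * k ≤ i → orthoNorm (Function.update m i t) k = orthoNorm m k := fun k hk =>
    orthoNorm_congr fun j hj => momentOf_update_of_le m i t (by omega)
  unfold recCoord
  split_ifs with hi
  · rcases hk : (i : ℕ) / 2 with _ | k
    · rw [zero_add, recB_one, recB_one, orthoNext_update m t (by omega) (hD _ (by omega)),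
        orthoNorm_zero, inv_one, mul_one]
    · rw [recB_succ_succ, recB_succ_succ, orthoNext_update m t (by omega) (hD _ (by omega)),
        hc _ (by omega), hc _ (by omega), orthoNext_congr (k := k) fun j hj =>
          momentOf_update_of_le m i t (by omega)]
      ring
  · rw [recA_succ, recA_succ, orthoNorm_update m t (by omega) (hD _ le_rfl), hc _ (by omega)]
    ring

theorem det_fderiv_recCoord {n : ℕ} {m : Fin (2 * n - 1) → ℝ}
    (hm : m ∈ posMoments (2 * n - 1) n) :
    (fderiv ℝ (recCoord : (Fin (2 * n - 1) → ℝ) → _) m).det =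
      ∏ i : Fin (2 * n - 1), (orthoNorm m ((i : ℕ) / 2))⁻¹ := by
  set f' := fderiv ℝ (recCoord : (Fin (2 * n - 1) → ℝ) → _) m
  have hf : HasFDerivAt recCoord f' m := (differentiableAt_recCoord hm).hasFDerivAt
  have hline : ∀ i j, HasDerivAt (fun t => recCoord (Function.update m j t) i)
      (f' (Pi.single j 1) i) (m j) := by
    intro i j
    have h1 : HasFDerivAt recCoord f' (Function.update m j (m j)) := by
      rwa [Function.update_eq_self]
    exact hasDerivAt_pi.1 (h1.comp_hasDerivAt (m j) (hasDerivAt_update m j (m j))) i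
  rw [ContinuousLinearMap.det, ← LinearMap.det_toMatrix', Matrix.det_of_isLowerTriangular]
  · refine Finset.prod_congr rfl fun i _ => ?_
    rw [LinearMap.toMatrix'_apply]
    have h1 := hline i i
    simp only [recCoord_update_self m i _ (fun k hk => hm k (by omega))] at h1
    have h2 : HasDerivAt (fun t => recCoord m i + (t - m i) * (orthoNorm m ((i : ℕ) / 2))⁻¹)
        (1 * (orthoNorm m ((i : ℕ) / 2))⁻¹) (m i) :=
      (((hasDerivAt_id (m i)).sub_const (m i)).mul_const _).const_add _
    rw [one_mul] at h2
    exact h1.unique h2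
  · intro i j hij
    have hij : i < j := hij
    rw [LinearMap.toMatrix'_apply]
    have h1 := hline i j
    simp only [recCoord_update_of_lt m _ hij] at h1
    exact h1.unique (hasDerivAt_const _ _)

theorem posMoments_anti {N k n : ℕ} (h : k ≤ n) : posMoments N n ⊆ posMoments N k :=
  fun _ hm j hj => hm j (hj.trans h)

theorem injOn_recCoord (n : ℕ) :
    Set.InjOn (recCoord : (Fin (2 * n - 1) → ℝ) → _) (posMoments (2 * n - 1) n) := by
  intro m hm m' hm' h
  suffices ∀ k : ℕ, ∀ i : Fin (2 * n - 1), (i : ℕ) < k → m i = m' i from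
    funext fun i => this _ i (Nat.lt_succ_self _)
  intro k
  induction k with
  | zero => intro i hi; omega
  | succ k ih =>
    intro i hi
    rcases Nat.lt_succ_iff_lt_or_eq.1 hi with hi | rfl
    · exact ih i hi
    -- After its entry `i` is replaced, `m` agrees with `m'` through order `i + 1`, hence has the
    -- same coefficient `i`; the affine formula then forces `m i = m' i`.
    have h1 := recCoord_update_self m i (m' i) fun k hk => hm k (by omega)
    have hmom : ∀ j ≤ (i : ℕ) + 1,
        momentOf (Function.update m i (m' i)) j = momentOf m' j := by
      intro j hj
      cases j with
      | zero => rfl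
      | succ j =>
        simp only [momentOf]
        split_ifs with hj'
        · rcases eq_or_ne (⟨j, hj'⟩ : Fin (2 * n - 1)) i with h | h
          · rw [h, Function.update_self]
          · rw [Function.update_of_ne h]
            exact ih _ (lt_of_le_of_ne (by simpa using hj) fun h' => h (Fin.ext h'))
        · rfl
    have h2 : recCoord (Function.update m i (m' i)) i = recCoord m' i := by
      unfold recCoord
      split_ifs with hi
      · exact recB_congr fun l hl => hmom l (by omega)
      · exact recA_congr fun l hl => hmom l (by omega)
    rw [h2, ← h, left_eq_add, mul_eq_zero, inv_eq_zero] at h1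
    rcases h1 with h1 | h1
    · exact (sub_eq_zero.1 h1).symm
    · exact absurd h1 (orthoNorm_pos hm (by omega)).ne'

/-- The range of the recursion coefficients: the coefficients `a_k` are positive. -/
def posCoords (N : ℕ) : Set (Fin N → ℝ) := {c | ∀ i : Fin N, (i : ℕ) % 2 = 1 → 0 < c i}

theorem mem_posMoments_iff_recCoord {n : ℕ} (k : ℕ) (hk : k < n) (m : Fin (2 * n - 1) → ℝ) :
    m ∈ posMoments (2 * n - 1) (k + 1) ↔
      ∀ i : Fin (2 * n - 1), (i : ℕ) < 2 * k → (i : ℕ) % 2 = 1 → 0 < recCoord m i := by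
  rw [mem_posMoments_iff_recA]
  constructor
  · intro h i hi hi2
    simp only [recCoord, hi2, one_ne_zero, if_false]
    exact h _ (by simp; omega)
  · intro h l hl
    simp only [Finset.mem_Icc, Nat.add_sub_cancel] at hl
    have := h ⟨2 * l - 1, by omega⟩ (by simp; omega) (by simp; omega)
    simp only [recCoord, show (2 * l - 1) % 2 = 1 by omega, one_ne_zero, if_false,
      show (2 * l - 1) / 2 + 1 = l by omega] at this
    exact this

/-- Moments are constructed successively by solving the affine equation for each prescribed
coefficient. The `a_k` already prescribed are positive, which keeps the slope nonzero. -/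
theorem image_recCoord {n : ℕ} (hn : 1 ≤ n) :
    recCoord '' posMoments (2 * n - 1) n = posCoords (2 * n - 1) := by
  obtain ⟨p, rfl⟩ : ∃ p, n = p + 1 := ⟨n - 1, by omega⟩
  ext c
  constructor
  · rintro ⟨m, hm, rfl⟩ i hi
    exact (mem_posMoments_iff_recCoord p (by omega) m).1 hm i (by omega) hi
  · intro hc
    have key : ∀ k : ℕ, ∃ m : Fin (2 * (p + 1) - 1) → ℝ,
        ∀ i : Fin (2 * (p + 1) - 1), (i : ℕ) < k → recCoord m i = c i := by
      intro k
      induction k with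
      | zero => exact ⟨0, fun i hi => by omega⟩
      | succ k ih =>
        obtain ⟨m, hm⟩ := ih
        rcases Nat.lt_or_ge k (2 * (p + 1) - 1) with hk | hk
        · set i : Fin (2 * (p + 1) - 1) := ⟨k, hk⟩
          have hpos : m ∈ posMoments (2 * (p + 1) - 1) ((i : ℕ) / 2 + 1) := by
            rw [mem_posMoments_iff_recCoord _ (by omega)]
            intro j hj hj2
            rw [hm j (by simp only [i] at hj; omega)]
            exact hc j hj2
          have h0 := (orthoNorm_pos hpos (Nat.lt_succ_self _)).ne'
          refine ⟨Function.update m i (m i + (c i - recCoord m i) * orthoNorm m ((i : ℕ) / 2)),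
            fun j hj => ?_⟩
          rcases Nat.lt_succ_iff_lt_or_eq.1 hj with hj | hj
          · rw [recCoord_update_of_lt m _ (show j < i from hj), hm j hj]
          · obtain rfl : j = i := Fin.ext hj
            rw [recCoord_update_self m _ _ hpos]
            field_simp
            ring
        · exact ⟨m, fun i hi => hm i (by omega)⟩
    obtain ⟨m, hm⟩ := key (2 * (p + 1) - 1)
    obtain rfl : recCoord m = c := funext fun i => hm i i.2
    refine ⟨m, ?_, rfl⟩
    rw [mem_posMoments_iff_recCoord p (by omega)]
    exact fun i _ hi => hc i hi

theorem lintegral_posCoords {n : ℕ} (hn : 1 ≤ n) (g : (Fin (2 * n - 1) → ℝ) → ℝ≥0∞) :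
    ∫⁻ m in posMoments (2 * n - 1) n,
      ENNReal.ofReal (∏ i : Fin (2 * n - 1), (orthoNorm m ((i : ℕ) / 2))⁻¹) * g (recCoord m) =
      ∫⁻ c in posCoords (2 * n - 1), g c := by
  rw [← image_recCoord hn, lintegral_image_eq_lintegral_abs_det_fderiv_mul volume
    (measurableSet_posMoments _ _)
    (fun m hm => (differentiableAt_recCoord hm).hasFDerivAt.hasFDerivWithinAt) (injOn_recCoord n)]
  refine setLIntegral_congr_fun (measurableSet_posMoments _ _) fun m hm => ?_
  rw [det_fderiv_recCoord hm, abs_of_pos]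
  exact Finset.prod_pos fun i _ => inv_pos.2 (orthoNorm_pos hm (by omega))

/-! ### The density in terms of the Hankel determinant -/

/-- The determinant is the product of the norms `a_1 ⋯ a_j` for `j < n`, in which `a_k` occurs `n -
k` times. -/
theorem hankelDet_rpow {N n : ℕ} {m : Fin N → ℝ} (hm : m ∈ posMoments N n) (s : ℝ) :
    hankelDet m n ^ s = ∏ k ∈ Finset.Icc 1 (n - 1), recA m k ^ (s * ((n : ℝ) - k)) := by
  rcases n with _ | n
  · simp [hankelDet_zero]
  have hs : ∀ k ∈ Finset.Icc 1 n, 0 < recA m k := by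
    simpa using (mem_posMoments_iff_recA m).1 hm
  rw [Nat.add_sub_cancel]
  induction n with
  | zero => simp [hankelDet_one]
  | succ n ih =>
    have hm' : m ∈ posMoments N (n + 1) := posMoments_anti (by omega) hm
    have ih := ih hm' fun k hk => hs k (by simp at hk ⊢; omega)
    have hD : hankelDet m (n + 2) = hankelDet m (n + 1) * orthoNorm m (n + 1) := by
      rw [hankelDet_eq_prod hm le_rfl, Finset.prod_range_succ,
        ← hankelDet_eq_prod hm (by omega : n + 1 ≤ n + 2)]
    have ha : ∏ k ∈ Finset.Icc 1 (n + 1), recA m k ^ (s * (((n + 1 + 1 : ℕ) : ℝ) - k)) =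
        (∏ k ∈ Finset.Icc 1 (n + 1), recA m k ^ (s * (((n + 1 : ℕ) : ℝ) - k))) *
          (∏ k ∈ Finset.Icc 1 (n + 1), recA m k) ^ s := by
      rw [← Real.finsetProd_rpow _ _ fun k hk => (hs k hk).le, ← Finset.prod_mul_distrib]
      refine Finset.prod_congr rfl fun k hk => ?_
      rw [← Real.rpow_add (hs k hk)]
      push_cast
      ring_nf
    rw [ha, hD, Real.mul_rpow (hm' _ le_rfl).le (orthoNorm_pos hm (by omega)).le, ih,
      ← orthoNorm_eq_prod hm (by omega), Finset.prod_Icc_succ_top (by omega)]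
    simp

/-- The constant factor of the density. -/
def densityConst (β : ℝ) (n : ℕ) : ℝ :=
  √((1 / 2) / Real.pi) ^ n * ∏ k ∈ Finset.Icc 1 (n - 1), (Real.Gamma (β / 2 * ((n : ℝ) - k)))⁻¹

theorem densityConst_pos {β : ℝ} (hβ : 0 < β) (n : ℕ) : 0 < densityConst β n := by
  refine mul_pos (pow_pos (Real.sqrt_pos.2 (by positivity)) _) (Finset.prod_pos fun k hk => ?_)
  have : (k : ℝ) < n := by
    simp at hk
    exact_mod_cast (by omega : k < n)
  have : 0 < (n : ℝ) - k := by linarith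
  exact inv_pos.2 (Real.Gamma_pos_of_pos (by positivity))

theorem hDensity_eq_zero {n : ℕ} {γ δ : ℕ → ℝ} {m : Fin (2 * n - 1) → ℝ}
    (hm : m ∉ posMoments (2 * n - 1) n) : hDensity n γ δ m = 0 := by
  rw [mem_posMoments_iff_recA] at hm
  push Not at hm
  obtain ⟨k, hk, h⟩ := hm
  rw [hDensity, Finset.prod_eq_zero (i := k) (s := Finset.Icc 1 (n - 1)) hk, mul_zero]
  rw [if_neg h.not_gt, mul_zero]

section density

variable {β : ℝ} {n : ℕ} {γ δ : ℕ → ℝ}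

theorem hDensity_eq (hδ_odd : ∀ k : ℕ, 1 ≤ k → k ≤ n → δ (2 * k - 1) = 1 / 2)
    (hδ_even : ∀ k : ℕ, 1 ≤ k → k ≤ n - 1 → δ (2 * k) = 1)
    (hγ : ∀ k : ℕ, 1 ≤ k → k ≤ n - 1 → γ k = (β / 2 - 2) * ((n : ℝ) - (k : ℝ)))
    {m : Fin (2 * n - 1) → ℝ} (hm : m ∈ posMoments (2 * n - 1) n) :
    hDensity n γ δ m = densityConst β n * hankelDet m n ^ (β / 2 - 2) *
      Real.exp (-(∑ k ∈ Finset.Icc 1 n, recB m k ^ 2 + 2 * ∑ k ∈ Finset.Icc 1 (n - 1), recA m k)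
        / 2) := by
  have h1 : ∏ k ∈ Finset.Icc 1 n, √(δ (2 * k - 1) / Real.pi) *
      Real.exp (-(δ (2 * k - 1)) * recB m k ^ 2) =
      √((1 / 2) / Real.pi) ^ n * Real.exp (∑ k ∈ Finset.Icc 1 n, -(1 / 2) * recB m k ^ 2) := by
    rw [Real.exp_sum, show √((1 / 2) / Real.pi) ^ n = ∏ _k ∈ Finset.Icc 1 n, √((1 / 2) / Real.pi) by
        rw [Finset.prod_const, Nat.card_Icc, Nat.add_sub_cancel],
      ← Finset.prod_mul_distrib]
    refine Finset.prod_congr rfl fun k hk => ?_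
    simp only [Finset.mem_Icc] at hk
    rw [hδ_odd k hk.1 hk.2]
  have h2 : ∏ k ∈ Finset.Icc 1 (n - 1), δ (2 * k) ^ (γ k + 2 * (n : ℝ) - 2 * (k : ℝ)) /
          Real.Gamma (γ k + 2 * (n : ℝ) - 2 * (k : ℝ)) *
        recA m k ^ γ k * Real.exp (-(δ (2 * k)) * recA m k) *
        (if 0 < recA m k then 1 else 0) =
      (∏ k ∈ Finset.Icc 1 (n - 1), (Real.Gamma (β / 2 * ((n : ℝ) - k)))⁻¹) *
        hankelDet m n ^ (β / 2 - 2) *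
        Real.exp (∑ k ∈ Finset.Icc 1 (n - 1), -recA m k) := by
    rw [hankelDet_rpow hm, Real.exp_sum, ← Finset.prod_mul_distrib, ← Finset.prod_mul_distrib]
    refine Finset.prod_congr rfl fun k hk => ?_
    have ha := (mem_posMoments_iff_recA m).1 hm k hk
    simp only [Finset.mem_Icc] at hk
    rw [hδ_even k hk.1 hk.2, hγ k hk.1 hk.2, if_pos ha, Real.one_rpow,
      show (β / 2 - 2) * ((n : ℝ) - k) + 2 * n - 2 * k = β / 2 * ((n : ℝ) - k) by ring]
    rw [one_div, mul_one, neg_one_mul]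
  rw [hDensity, h1, h2, densityConst]
  have h3 : Real.exp (-(∑ k ∈ Finset.Icc 1 n, recB m k ^ 2 +
      2 * ∑ k ∈ Finset.Icc 1 (n - 1), recA m k) / 2) =
      Real.exp (∑ k ∈ Finset.Icc 1 n, -(1 / 2) * recB m k ^ 2) *
        Real.exp (∑ k ∈ Finset.Icc 1 (n - 1), -recA m k) := by
    rw [← Real.exp_add, ← Finset.mul_sum, Finset.sum_neg_distrib]
    ring_nf
  rw [h3]
  ring

/-! ### The total mass of the density -/

theorem prod_fin_eq_prod_Icc {M : Type*} [CommMonoid M] (hn : 1 ≤ n) (F : ℕ → M) :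
    ∏ i : Fin (2 * n - 1), F i =
      (∏ k ∈ Finset.Icc 1 n, F (2 * k - 2)) * ∏ k ∈ Finset.Icc 1 (n - 1), F (2 * k - 1) := by
  rw [← Finset.prod_range]
  obtain ⟨p, rfl⟩ : ∃ p, n = p + 1 := ⟨n - 1, by omega⟩
  clear hn
  rw [Nat.add_sub_cancel]
  induction p with
  | zero => simp
  | succ p ih =>
    rw [show 2 * (p + 1 + 1) - 1 = (2 * (p + 1) - 1) + 1 + 1 by omega, Finset.prod_range_succ,
      Finset.prod_range_succ, ih, Finset.prod_Icc_succ_top (b := p + 1) (by omega),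
      Finset.prod_Icc_succ_top (b := p) (by omega) fun k => F (2 * k - 1),
      show 2 * (p + 1) - 1 + 1 = 2 * (p + 1 + 1) - 2 by omega]
    rw [mul_assoc, mul_comm (F (2 * (p + 1) - 1)), mul_mul_mul_comm]

theorem lintegral_fin_prod {N : ℕ} (g : Fin N → ℝ → ℝ≥0∞) (hg : ∀ i, Measurable (g i)) :
    ∫⁻ c : Fin N → ℝ, ∏ i, g i (c i) = ∏ i, ∫⁻ t, g i t := by
  induction N with
  | zero => simp [volume_pi]
  | succ N ih =>
    rw [← (volume_preserving_piFinSuccAbove (fun _ : Fin (N + 1) => ℝ) 0).symm.lintegral_comp_emb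
      (MeasurableEquiv.measurableEmbedding _)]
    simp_rw [MeasurableEquiv.piFinSuccAbove_symm_apply, Fin.insertNthEquiv,
      Fin.prod_univ_succ, Fin.insertNth_zero, Equiv.coe_fn_mk, Fin.cons_succ, Fin.cons_zero]
    rw [← ih (fun i => g i.succ) fun i => hg i.succ]
    exact lintegral_prod_mul (hg 0).aemeasurable (Finset.measurable_prod _ fun (i : Fin N) _ =>
      (hg i.succ).comp (measurable_pi_apply i)).aemeasurable

/-- The densities of the independent recursion coefficients: Gaussian for the `b_k` and Gamma for
the `a_k`. -/
def coordDensity (β : ℝ) (n : ℕ) (i : ℕ) : ℝ → ℝ :=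
  if i % 2 = 0 then gaussianPDFReal 0 1
  -- The Gamma density need not vanish at zero; the indicator confines the support of the product to
  -- `posCoords`.
  else (Set.Ioi 0).indicator (gammaPDFReal (β / 2 * ((n : ℝ) - (i / 2 + 1 : ℕ))) 1)

theorem measurable_coordDensity (i : ℕ) : Measurable (coordDensity β n i) := by
  unfold coordDensity
  split_ifs
  · exact measurable_gaussianPDFReal 0 1
  · exact (measurable_gammaPDFReal _ _).indicator measurableSet_Ioi

theorem coordDensity_param_pos (hβ : 0 < β) {i : ℕ} (hi : i + 1 < 2 * n) (hi2 : i % 2 = 1) :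
    0 < β / 2 * ((n : ℝ) - (i / 2 + 1 : ℕ)) := by
  have : ((i / 2 + 1 : ℕ) : ℝ) < n := by exact_mod_cast (by omega : i / 2 + 1 < n)
  have : 0 < (n : ℝ) - (i / 2 + 1 : ℕ) := by linarith
  positivity

theorem lintegral_coordDensity (hβ : 0 < β) {i : ℕ} (hi : i + 1 < 2 * n) :
    ∫⁻ t, ENNReal.ofReal (coordDensity β n i t) = 1 := by
  unfold coordDensity
  split_ifs with h
  · exact lintegral_gaussianPDFReal_eq_one 0 one_ne_zero
  · rw [← lintegral_gammaPDF_eq_one (coordDensity_param_pos hβ hi (by omega)) zero_lt_one]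
    refine lintegral_congr_ae ?_
    filter_upwards [Measure.ae_ne volume (0 : ℝ)] with t ht
    rcases lt_or_gt_of_ne ht with h | h
    · rw [gammaPDF_of_neg h, Set.indicator_of_notMem (by simpa using h.le), ENNReal.ofReal_zero]
    · rw [Set.indicator_of_mem (by simpa using h), gammaPDF]

theorem coordDensity_nonneg (hβ : 0 < β) {i : ℕ} (hi : i + 1 < 2 * n) (t : ℝ) :
    0 ≤ coordDensity β n i t := by
  unfold coordDensity
  split_ifs with h
  · exact gaussianPDFReal_nonneg 0 1 t
  · exact Set.indicator_nonneg
      (fun _ _ => gammaPDFReal_nonneg (coordDensity_param_pos hβ hi (by omega)) zero_lt_one _) _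

theorem lintegral_prod_coordDensity (hβ : 0 < β) :
    ∫⁻ c in posCoords (2 * n - 1),
      ∏ i : Fin (2 * n - 1), ENNReal.ofReal (coordDensity β n i (c i)) = 1 := by
  have hmeas : MeasurableSet (posCoords (2 * n - 1)) := by
    have : posCoords (2 * n - 1) = ⋂ i : Fin (2 * n - 1), ⋂ _ : (i : ℕ) % 2 = 1,
        {c | 0 < c i} := by
      ext c; simp [posCoords]
    rw [this]
    exact MeasurableSet.iInter fun i => MeasurableSet.iInter fun _ =>
      measurableSet_lt measurable_const (measurable_pi_apply i)
  rw [setLIntegral_eq_of_support_subset, lintegral_fin_prod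
    (fun i : Fin (2 * n - 1) => fun t => ENNReal.ofReal (coordDensity β n i t))
    fun i => (measurable_coordDensity i).ennreal_ofReal]
  · exact Finset.prod_eq_one fun i _ => lintegral_coordDensity hβ (by omega)
  · intro c hc i hi
    by_contra h
    refine hc (Finset.prod_eq_zero (Finset.mem_univ i) ?_)
    rw [coordDensity, if_neg (by omega), Set.indicator_of_notMem (by simpa using h),
      ENNReal.ofReal_zero]

/-- The Jacobian is `1 / (D_n D_{n-1})`, and the powers in the Gamma densities multiply to `D_n ^
(β/2) / ∏ a_k`. As `D_n = D_{n-1} ∏ a_k`, together they give `D_n ^ (β/2 - 2)`. -/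
theorem hDensity_eq_mul_coordDensity (hn : 1 ≤ n)
    (hδ_odd : ∀ k : ℕ, 1 ≤ k → k ≤ n → δ (2 * k - 1) = 1 / 2)
    (hδ_even : ∀ k : ℕ, 1 ≤ k → k ≤ n - 1 → δ (2 * k) = 1)
    (hγ : ∀ k : ℕ, 1 ≤ k → k ≤ n - 1 → γ k = (β / 2 - 2) * ((n : ℝ) - (k : ℝ)))
    {m : Fin (2 * n - 1) → ℝ} (hm : m ∈ posMoments (2 * n - 1) n) :
    hDensity n γ δ m = (∏ i : Fin (2 * n - 1), (orthoNorm m ((i : ℕ) / 2))⁻¹) *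
      ∏ i : Fin (2 * n - 1), coordDensity β n i (recCoord m i) := by
  have ha := (mem_posMoments_iff_recA m).1 hm
  have hD : 0 < hankelDet m n := hm n le_rfl
  have hD' : 0 < hankelDet m (n - 1) := hm (n - 1) (by omega)
  have hDD : hankelDet m n = hankelDet m (n - 1) * ∏ k ∈ Finset.Icc 1 (n - 1), recA m k := by
    rw [← orthoNorm_eq_prod hm (by omega), orthoNorm_eq, Nat.sub_add_cancel hn,
      mul_inv_cancel_left₀ hD'.ne']
  have hrange : ∀ k ≤ n, ∏ j ∈ Finset.Icc 1 k, (orthoNorm m (j - 1))⁻¹ = (hankelDet m k)⁻¹ := by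
    intro k hk
    rw [hankelDet_eq_prod hm hk, ← Finset.prod_inv_distrib, Finset.range_eq_Ico,
      Finset.prod_Ico_eq_prod_range, ← Finset.Ico_add_one_right_eq_Icc,
      Finset.prod_Ico_eq_prod_range]
    simp [add_comm]
  have hnorm : ∏ i : Fin (2 * n - 1), (orthoNorm m ((i : ℕ) / 2))⁻¹ =
      (hankelDet m n)⁻¹ * (hankelDet m (n - 1))⁻¹ := by
    rw [prod_fin_eq_prod_Icc hn fun i => (orthoNorm m (i / 2))⁻¹, ← hrange n le_rfl,
      ← hrange (n - 1) (by omega)]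
    congr 1 <;> refine Finset.prod_congr rfl fun k hk => ?_ <;> simp only [Finset.mem_Icc] at hk
    · rw [show (2 * k - 2) / 2 = k - 1 by omega]
    · rw [show (2 * k - 1) / 2 = k - 1 by omega]
  set F : ℕ → ℝ := fun i => coordDensity β n i
    (if i % 2 = 0 then recB m (i / 2 + 1) else recA m (i / 2 + 1)) with hF
  have hG : ∏ i : Fin (2 * n - 1), coordDensity β n i (recCoord m i) =
      ∏ i : Fin (2 * n - 1), F i := rfl
  have hE : ∏ k ∈ Finset.Icc 1 n, F (2 * k - 2) =
      √((1 / 2) / Real.pi) ^ n * Real.exp (∑ k ∈ Finset.Icc 1 n, -(1 / 2) * recB m k ^ 2) := by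
    rw [Real.exp_sum, show √((1 / 2) / Real.pi) ^ n = ∏ _k ∈ Finset.Icc 1 n, √((1 / 2) / Real.pi) by
        rw [Finset.prod_const, Nat.card_Icc, Nat.add_sub_cancel],
      ← Finset.prod_mul_distrib]
    refine Finset.prod_congr rfl fun k hk => ?_
    simp only [Finset.mem_Icc] at hk
    simp only [hF, show (2 * k - 2) % 2 = 0 by omega, if_true, coordDensity, gaussianPDFReal,
      show (2 * k - 2) / 2 + 1 = k by omega]
    congr 1
    · rw [← Real.sqrt_inv]
      congr 1
      simp
      ring
    · congr 1
      simp
      ring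
  have hO : ∏ k ∈ Finset.Icc 1 (n - 1), F (2 * k - 1) =
      (∏ k ∈ Finset.Icc 1 (n - 1), (Real.Gamma (β / 2 * ((n : ℝ) - k)))⁻¹) *
        hankelDet m n ^ (β / 2) * (∏ k ∈ Finset.Icc 1 (n - 1), recA m k)⁻¹ *
        Real.exp (∑ k ∈ Finset.Icc 1 (n - 1), -recA m k) := by
    rw [hankelDet_rpow hm, Real.exp_sum, ← Finset.prod_inv_distrib, ← Finset.prod_mul_distrib,
      ← Finset.prod_mul_distrib, ← Finset.prod_mul_distrib]
    refine Finset.prod_congr rfl fun k hk => ?_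
    have hk0 := ha k hk
    simp only [Finset.mem_Icc] at hk
    simp only [hF, show (2 * k - 1) % 2 = 1 by omega, one_ne_zero, if_false, coordDensity,
      show (2 * k - 1) / 2 + 1 = k by omega]
    rw [Set.indicator_of_mem (by simpa using hk0), gammaPDFReal, if_pos hk0.le, Real.one_rpow,
      Real.rpow_sub hk0, Real.rpow_one, one_mul]
    ring
  have hexp : Real.exp (-(∑ k ∈ Finset.Icc 1 n, recB m k ^ 2 +
      2 * ∑ k ∈ Finset.Icc 1 (n - 1), recA m k) / 2) =
      Real.exp (∑ k ∈ Finset.Icc 1 n, -(1 / 2) * recB m k ^ 2) *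
        Real.exp (∑ k ∈ Finset.Icc 1 (n - 1), -recA m k) := by
    rw [← Real.exp_add, ← Finset.mul_sum, Finset.sum_neg_distrib]
    ring_nf
  rw [hDensity_eq hδ_odd hδ_even hγ hm, hnorm, hG, prod_fin_eq_prod_Icc hn, hE, hO, hexp,
    Real.rpow_sub hD, Real.rpow_two, densityConst]
  have hq : (hankelDet m n)⁻¹ * (hankelDet m (n - 1))⁻¹ *
      (∏ k ∈ Finset.Icc 1 (n - 1), recA m k)⁻¹ = (hankelDet m n ^ 2)⁻¹ := by
    rw [sq, mul_inv, mul_assoc, ← mul_inv (hankelDet m (n - 1)), ← hDD]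
  rw [div_eq_mul_inv (_ ^ (β / 2)), ← hq]
  ring

theorem lintegral_hDensity (hβ : 0 < β) (hn : 1 ≤ n)
    (hδ_odd : ∀ k : ℕ, 1 ≤ k → k ≤ n → δ (2 * k - 1) = 1 / 2)
    (hδ_even : ∀ k : ℕ, 1 ≤ k → k ≤ n - 1 → δ (2 * k) = 1)
    (hγ : ∀ k : ℕ, 1 ≤ k → k ≤ n - 1 → γ k = (β / 2 - 2) * ((n : ℝ) - (k : ℝ))) :
    ∫⁻ m in posMoments (2 * n - 1) n, ENNReal.ofReal (hDensity n γ δ m) = 1 := by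
  rw [← lintegral_prod_coordDensity (n := n) hβ, ← lintegral_posCoords hn]
  refine setLIntegral_congr_fun (measurableSet_posMoments _ _) fun m hm => ?_
  rw [hDensity_eq_mul_coordDensity hn hδ_odd hδ_even hγ hm, ENNReal.ofReal_mul,
    ENNReal.ofReal_prod_of_nonneg (f := fun i : Fin (2 * n - 1) =>
      coordDensity β n i (recCoord m i)) fun i _ => coordDensity_nonneg hβ (by omega) _]
  exact Finset.prod_nonneg fun i _ => (inv_pos.2 (orthoNorm_pos hm (by omega))).le

end density

/-! ### The random moment vector -/

/-- On the measurable set of measures with a finite absolute moment, the integral is a difference of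
two lower integrals, each measurable in the measure. Elsewhere it takes the default value zero. -/
theorem measurable_momentVector (N : ℕ) : Measurable (momentVector N) := by
  refine measurable_pi_lambda _ fun k => ?_
  have hf : Measurable fun x : ℝ => x ^ ((k : ℕ) + 1) := by fun_prop
  have h1 : MeasurableSet {ν : Measure ℝ | ∫⁻ x, ‖x ^ ((k : ℕ) + 1)‖ₑ ∂ν < ⊤} :=
    measurableSet_lt (Measure.measurable_lintegral hf.enorm) measurable_const
  have h2 : (fun ν : Measure ℝ => momentVector N ν k) =
      Set.indicator {ν | ∫⁻ x, ‖x ^ ((k : ℕ) + 1)‖ₑ ∂ν < ⊤} fun ν =>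
        (∫⁻ x, ENNReal.ofReal (x ^ ((k : ℕ) + 1)) ∂ν).toReal -
          (∫⁻ x, ENNReal.ofReal (-x ^ ((k : ℕ) + 1)) ∂ν).toReal := by
    funext ν
    by_cases h : ν ∈ {ν : Measure ℝ | ∫⁻ x, ‖x ^ ((k : ℕ) + 1)‖ₑ ∂ν < ⊤}
    · rw [Set.indicator_of_mem h, momentVector,
        integral_eq_lintegral_pos_part_sub_lintegral_neg_part ⟨hf.aestronglyMeasurable, h⟩]
    · rw [Set.indicator_of_notMem h, momentVector, integral_undef fun hi => h hi.2]
  rw [h2]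
  exact ((Measure.measurable_lintegral hf.ennreal_ofReal).ennreal_toReal.sub
    (Measure.measurable_lintegral hf.neg.ennreal_ofReal).ennreal_toReal).indicator h1

theorem measurable_discreteMeasure (n : ℕ) :
    Measurable fun q : (Fin n → ℝ) × (Fin n → ℝ) => discreteMeasure q.1 q.2 := by
  refine Measure.measurable_of_measurable_coe _ fun s hs => ?_
  simp only [discreteMeasure, Measure.coe_finsetSum, Finset.sum_apply, Measure.smul_apply,
    smul_eq_mul, Measure.dirac_apply' _ hs]
  refine Finset.measurable_sum _ fun i _ => Measurable.mul (by fun_prop) ?_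
  exact (measurable_one.indicator hs).comp ((measurable_pi_apply i).comp measurable_fst)

theorem integrable_discreteMeasure {n : ℕ} (x w : Fin n → ℝ) (f : ℝ → ℝ) :
    Integrable f (discreteMeasure x w) := by
  rw [discreteMeasure, integrable_finsetSum_measure]
  exact fun i _ => (integrable_dirac (by simp)).smul_measure ENNReal.ofReal_ne_top

theorem momentVector_discreteMeasure {n : ℕ} (N : ℕ) (x : Fin n → ℝ) {w : Fin n → ℝ}
    (hw : ∀ i, 0 ≤ w i) : momentVector N (discreteMeasure x w) = nodeMoments N x w := by
  funext k
  rw [momentVector, discreteMeasure, integral_finsetSum_measure]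
  · refine Finset.sum_congr rfl fun i _ => ?_
    rw [integral_smul_measure, integral_dirac, ENNReal.toReal_ofReal (hw i), smul_eq_mul]
  · exact fun i _ => (integrable_dirac (by simp)).smul_measure ENNReal.ofReal_ne_top

theorem posMoments_subset_momentSpace {n : ℕ} (hn : 1 ≤ n) :
    posMoments (2 * n - 1) n ⊆ momentSpace (2 * n - 1) := by
  intro m hm
  obtain ⟨x, w, -, hw0, hw, rfl⟩ := exists_nodeMoments_eq hn hm
  refine ⟨discreteMeasure x w, ⟨?_⟩, fun k => integrable_discreteMeasure x w _,
    momentVector_discreteMeasure _ x fun i => (hw0 i).le⟩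
  simp only [discreteMeasure, Measure.coe_finsetSum, Finset.sum_apply, Measure.smul_apply,
    smul_eq_mul, measure_univ, mul_one]
  rw [← ENNReal.ofReal_sum_of_nonneg fun i _ => (hw0 i).le, hw, ENNReal.ofReal_one]

/-- The density vanishes off `posMoments`, a measurable subset of the moment space; measurability of
the moment space itself is not needed. -/
theorem withDensity_momentSpace {n : ℕ} (hn : 1 ≤ n) (γ δ : ℕ → ℝ) :
    ((volume.restrict (momentSpace (2 * n - 1))).withDensity fun m =>
      ENNReal.ofReal (hDensity n γ δ m)) =
      (volume.restrict (posMoments (2 * n - 1) n)).withDensity fun m =>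
        ENNReal.ofReal (hDensity n γ δ m) := by
  have hpos := measurableSet_posMoments (2 * n - 1) n
  have : (fun m => ENNReal.ofReal (hDensity n γ δ m)) =
      (posMoments (2 * n - 1) n).indicator fun m => ENNReal.ofReal (hDensity n γ δ m) := by
    funext m
    by_cases hm : m ∈ posMoments (2 * n - 1) n
    · rw [Set.indicator_of_mem hm]
    · rw [Set.indicator_of_notMem hm, hDensity_eq_zero hm, ENNReal.ofReal_zero]
  conv_lhs => rw [this]
  rw [withDensity_indicator hpos, Measure.restrict_restrict hpos,
    Set.inter_eq_self_of_subset_left (posMoments_subset_momentSpace hn)]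

/-- The Dirichlet density in the coordinates `w_1, …, w_{n-1}`. -/
def dirichletDensity (β : ℝ) (n : ℕ) (w : Fin n → ℝ) : ℝ :=
  Real.Gamma (n * β / 2) / Real.Gamma (β / 2) ^ n * (∏ i : Fin n, w i ^ (β / 2 - 1)) *
    (if ∀ i : Fin n, 0 < w i then 1 else 0)

/-- The normalized density of the nodes. -/
def hermiteDensity (β : ℝ) (n : ℕ) (x : Fin n → ℝ) : ℝ :=
  (∫ y : Fin n → ℝ, hermiteWeight β n y)⁻¹ * hermiteWeight β n x

theorem measurable_dirichletDensity (β : ℝ) (n : ℕ) : Measurable (dirichletDensity β n) := by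
  unfold dirichletDensity
  refine Measurable.mul (by fun_prop) (Measurable.ite ?_ measurable_const measurable_const)
  rw [Set.ofPred_forall]
  exact MeasurableSet.iInter fun i => measurableSet_lt measurable_const (measurable_pi_apply i)

theorem measurable_hermiteDensity (β : ℝ) (n : ℕ) : Measurable (hermiteDensity β n) := by
  unfold hermiteDensity hermiteWeight
  fun_prop

theorem hermiteWeight_nonneg (β : ℝ) (n : ℕ) (x : Fin n → ℝ) : 0 ≤ hermiteWeight β n x :=
  mul_nonneg (Real.rpow_nonneg (abs_nonneg _) _) (Finset.prod_nonneg fun _ _ => (Real.exp_pos _).le)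

/-- The nodes and the free weights of a point of `ℝ ^ (2 n - 1)`. -/
def splitCoords (n : ℕ) (y : Fin (2 * n - 1) → ℝ) : (Fin n → ℝ) × (Fin (n - 1) → ℝ) :=
  (nodesOf n y, fun j => y (sumIndexEquiv n (.inl j)))

theorem measurePreserving_splitCoords (n : ℕ) : MeasurePreserving (splitCoords n) := by
  have h1 := (volume_measurePreserving_piCongrLeft (fun _ => ℝ) (sumIndexEquiv n)).symm
  have h2 := volume_measurePreserving_sumPiEquivProdPi
    (fun _ : Fin (n - 1) ⊕ Fin n => ℝ)
  exact (Measure.measurePreserving_swap.comp h2).comp h1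

/-- The joint density of nodes and weights. -/
def spectralDensity (β : ℝ) (n : ℕ) (y : Fin (2 * n - 1) → ℝ) : ℝ≥0∞ :=
  ENNReal.ofReal (hermiteDensity β n (nodesOf n y)) *
    ENNReal.ofReal (dirichletDensity β n (weightsOf n y))

theorem map_momentVector_gaussianSpectralLaw (β : ℝ) (n : ℕ) {A : Set (Fin (2 * n - 1) → ℝ)}
    (hA : MeasurableSet A) :
    (gaussianSpectralLaw β n).map (momentVector (2 * n - 1)) A =
      ∫⁻ y in spectralMoments n ⁻¹' A, spectralDensity β n y := by
  set f₁ : (Fin n → ℝ) → ℝ≥0∞ := fun x => ENNReal.ofReal (hermiteDensity β n x) with hf₁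
  set f₂ : (Fin (n - 1) → ℝ) → ℝ≥0∞ := fun v =>
    ENNReal.ofReal (dirichletDensity β n (completeWeights n v)) with hf₂
  have hcw : Measurable (completeWeights n) := (continuous_completeWeights n).measurable
  have hm₁ : Measurable f₁ := (measurable_hermiteDensity β n).ennreal_ofReal
  have hm₂ : Measurable f₂ := ((measurable_dirichletDensity β n).comp hcw).ennreal_ofReal
  have hm : Measurable fun z : (Fin n → ℝ) × (Fin (n - 1) → ℝ) => f₁ z.1 * f₂ z.2 :=
    (hm₁.comp measurable_fst).mul (hm₂.comp measurable_snd)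
  have hD := measurable_discreteMeasure n
  have hprod : (hermiteEnsemble β n).prod (dirichletWeights β n) =
      ((volume.prod volume).withDensity fun z => f₁ z.1 * f₂ z.2).map
        (Prod.map id (completeWeights n)) := by
    rw [← prod_withDensity hm₁ hm₂, ← Measure.map_prod_map _ _ measurable_id hcw, Measure.map_id]
    rfl
  set Φ : (Fin n → ℝ) × (Fin (n - 1) → ℝ) → Fin (2 * n - 1) → ℝ := fun z =>
    nodeMoments (2 * n - 1) z.1 (completeWeights n z.2) with hΦ
  have hΦm : Measurable Φ := by
    have : ∀ i, Measurable fun z : (Fin n → ℝ) × (Fin (n - 1) → ℝ) =>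
        completeWeights n z.2 i := fun i =>
      (measurable_pi_apply i).comp (hcw.comp measurable_snd)
    simp only [hΦ]
    unfold nodeMoments
    fun_prop
  -- `discreteMeasure` truncates negative weights to zero, so the moment formula is claimed only
  -- almost everywhere: the Dirichlet density vanishes unless all weights are positive.
  have hae : (momentVector (2 * n - 1) ∘ fun q : (Fin n → ℝ) × (Fin n → ℝ) =>
      discreteMeasure q.1 q.2) ∘ Prod.map id (completeWeights n)
      =ᵐ[(volume.prod volume).withDensity fun z => f₁ z.1 * f₂ z.2] Φ := by
    refine (ae_withDensity_iff hm).2 (Filter.Eventually.of_forall fun z hz => ?_)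
    refine momentVector_discreteMeasure _ z.1 fun i => ?_
    by_contra hi
    refine hz ?_
    have : ¬ ∀ i, 0 < completeWeights n z.2 i := fun h => hi (h i).le
    simp only [hf₂, dirichletDensity, if_neg this, mul_zero, ENNReal.ofReal_zero]
  rw [gaussianSpectralLaw, hprod, Measure.map_map hD (measurable_id.prodMap hcw),
    Measure.map_map (measurable_momentVector _) (hD.comp (measurable_id.prodMap hcw)),
    ← Function.comp_assoc, Measure.map_congr hae, Measure.map_apply hΦm hA,
    withDensity_apply _ (hΦm hA)]
  have hS := measurePreserving_splitCoords n
  rw [← Measure.volume_eq_prod, ← hS.map_eq, setLIntegral_map (hΦm hA) hm hS.measurable]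
  rfl

/-- With positive weights, distinct nodes can be sorted into some chamber. Otherwise two nodes
coincide and `|Δ| ^ β = 0`, because `β ≠ 0`. -/
theorem spectralDensity_eq_zero {β : ℝ} (hβ : 0 < β) {n : ℕ} {y : Fin (2 * n - 1) → ℝ}
    (hy : ∀ σ, y ∉ chamber n σ) : spectralDensity β n y = 0 := by
  by_cases hw : ∀ i, 0 < weightsOf n y i
  · have hx : ¬ Function.Injective (nodesOf n y) := fun hx =>
      hy (Tuple.sort (nodesOf n y)) ⟨(Tuple.monotone_sort _).strictMono_of_injective
        (hx.comp (Tuple.sort _).injective), hw⟩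
    rw [← Matrix.det_vandermonde_ne_zero_iff, not_not, Matrix.det_vandermonde] at hx
    simp [spectralDensity, hermiteDensity, hermiteWeight, hx, Real.zero_rpow hβ.ne']
  · simp only [spectralDensity, dirichletDensity, if_neg hw, mul_zero, ENNReal.ofReal_zero]

theorem pairwise_disjoint_chamber (n : ℕ) :
    Pairwise (Function.onFun Disjoint (chamber n)) := by
  intro σ τ hστ
  rw [Function.onFun, Set.disjoint_left]
  intro y hσ hτ
  refine hστ ?_
  have h := (StrictMono.range_inj hσ.1 hτ.1).1
    (by rw [σ.surjective.range_comp, τ.surjective.range_comp])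
  exact Equiv.ext fun i => injective_of_mem_chamber hσ (congrFun h i)

/-- The constant relating the density of the nodes and weights to that of the moments. -/
def spectralConst (β : ℝ) (n : ℕ) : ℝ :=
  (∫ y : Fin n → ℝ, hermiteWeight β n y)⁻¹ *
    (Real.Gamma (n * β / 2) / Real.Gamma (β / 2) ^ n) * (densityConst β n)⁻¹

section law

variable {β : ℝ} {n : ℕ} {γ δ : ℕ → ℝ}

theorem spectralDensity_eq (hβ : 0 < β) (hn : 1 ≤ n)
    (hδ_odd : ∀ k : ℕ, 1 ≤ k → k ≤ n → δ (2 * k - 1) = 1 / 2)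
    (hδ_even : ∀ k : ℕ, 1 ≤ k → k ≤ n - 1 → δ (2 * k) = 1)
    (hγ : ∀ k : ℕ, 1 ≤ k → k ≤ n - 1 → γ k = (β / 2 - 2) * ((n : ℝ) - (k : ℝ)))
    {σ : Equiv.Perm (Fin n)} {y : Fin (2 * n - 1) → ℝ} (hy : y ∈ chamber n σ) :
    spectralDensity β n y = ENNReal.ofReal (spectralConst β n) *
      (ENNReal.ofReal (|∏ i, weightsOf n y i| * (Matrix.vandermonde (nodesOf n y)).det ^ 4) *
        ENNReal.ofReal (hDensity n γ δ (spectralMoments n y))) := by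
  have hx := injective_of_mem_chamber hy
  have hw := hy.2
  have hw1 : ∑ i, weightsOf n y i = 1 := sum_completeWeights hn _
  have hpos : spectralMoments n y ∈ posMoments (2 * n - 1) n :=
    nodeMoments_mem_posMoments hx hw hw1 (by omega)
  have hC := densityConst_pos hβ n
  have hZ : 0 ≤ (∫ y : Fin n → ℝ, hermiteWeight β n y)⁻¹ :=
    inv_nonneg.2 (integral_nonneg fun _ => hermiteWeight_nonneg β n _)
  have hH : 0 ≤ hermiteDensity β n (nodesOf n y) := mul_nonneg hZ (hermiteWeight_nonneg β n _)
  have hΓ : 0 ≤ Real.Gamma (n * β / 2) / Real.Gamma (β / 2) ^ n := by positivity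
  have hK : 0 ≤ spectralConst β n := mul_nonneg (mul_nonneg hZ hΓ) (inv_nonneg.2 hC.le)
  have hW : 0 < ∏ i, weightsOf n y i := Finset.prod_pos fun i _ => hw i
  have hV : 0 < |(Matrix.vandermonde (nodesOf n y)).det| :=
    abs_pos.2 (Matrix.det_vandermonde_ne_zero_iff.2 hx)
  rw [spectralDensity, ← ENNReal.ofReal_mul hH,
    ← ENNReal.ofReal_mul (by positivity), ← ENNReal.ofReal_mul hK]
  congr 1
  have h1 : hankelDet (spectralMoments n y) n =
      (∏ i, weightsOf n y i) * |(Matrix.vandermonde (nodesOf n y)).det| ^ 2 := by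
    rw [sq_abs]
    exact hankelDet_nodeMoments hw1 (by omega)
  have h2 := sum_sq_nodes hx hw hw1 (by omega : 2 * n ≤ 2 * n - 1 + 1)
  have hexp : ∏ i, Real.exp (-(nodesOf n y i) ^ 2 / 2) =
      Real.exp (-(∑ i, nodesOf n y i ^ 2) / 2) := by
    rw [← Real.exp_sum, ← Finset.sum_div, Finset.sum_neg_distrib]
  rw [hDensity_eq hδ_odd hδ_even hγ hpos, h1, spectralMoments, ← h2, hermiteDensity,
    hermiteWeight, hexp, dirichletDensity, if_pos hw, mul_one, ← Matrix.det_vandermonde,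
    Real.finsetProd_rpow _ _ fun i _ => (hw i).le, abs_of_pos hW, spectralConst]
  set W := ∏ i, weightsOf n y i
  have h4 : (Matrix.vandermonde (nodesOf n y)).det ^ 4 =
      |(Matrix.vandermonde (nodesOf n y)).det| ^ 4 := by
    rw [Even.pow_abs (by decide)]
  rw [h4]
  set V := |(Matrix.vandermonde (nodesOf n y)).det|
  -- This is where the exponents match: the denominators `W` and `V ^ 4` are exactly the Jacobian.
  have h5 : (W * V ^ 2) ^ (β / 2 - 2) = W ^ (β / 2 - 1) / W * (V ^ β / V ^ 4) := by
    rw [Real.mul_rpow hW.le (by positivity), ← Real.rpow_natCast V 2, ← Real.rpow_mul hV.le,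
      ← Real.rpow_natCast V 4, ← Real.rpow_sub hV, ← Real.rpow_sub_one hW.ne']
    congr 2 <;> push_cast <;> ring
  rw [h5]
  field_simp

theorem map_momentVector_apply (hβ : 0 < β) (hn : 1 ≤ n)
    (hδ_odd : ∀ k : ℕ, 1 ≤ k → k ≤ n → δ (2 * k - 1) = 1 / 2)
    (hδ_even : ∀ k : ℕ, 1 ≤ k → k ≤ n - 1 → δ (2 * k) = 1)
    (hγ : ∀ k : ℕ, 1 ≤ k → k ≤ n - 1 → γ k = (β / 2 - 2) * ((n : ℝ) - (k : ℝ)))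
    {A : Set (Fin (2 * n - 1) → ℝ)} (hA : MeasurableSet A) :
    (gaussianSpectralLaw β n).map (momentVector (2 * n - 1)) A =
      (Fintype.card (Equiv.Perm (Fin n)) * ENNReal.ofReal (spectralConst β n)) *
        ∫⁻ m in posMoments (2 * n - 1) n,
          A.indicator (fun m => ENNReal.ofReal (hDensity n γ δ m)) m := by
  have hsm : Measurable (spectralMoments n) := (continuous_spectralMoments n).measurable
  rw [map_momentVector_gaussianSpectralLaw β n hA, ← lintegral_indicator (hsm hA),
    ← setLIntegral_eq_of_support_subset (s := ⋃ σ, chamber n σ), lintegral_iUnion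
      (measurableSet_chamber n) (pairwise_disjoint_chamber n), tsum_fintype]
  · have h : ∀ σ, ∫⁻ y in chamber n σ,
        (spectralMoments n ⁻¹' A).indicator (spectralDensity β n) y =
        ENNReal.ofReal (spectralConst β n) * ∫⁻ m in posMoments (2 * n - 1) n,
          A.indicator (fun m => ENNReal.ofReal (hDensity n γ δ m)) m := by
      intro σ
      rw [← lintegral_chamber hn σ, ← lintegral_const_mul' _ _ ENNReal.ofReal_ne_top]
      refine setLIntegral_congr_fun (measurableSet_chamber n σ) fun y hy => ?_
      by_cases hyA : spectralMoments n y ∈ A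
      · rw [Set.indicator_of_mem (show y ∈ spectralMoments n ⁻¹' A from hyA),
          Set.indicator_of_mem hyA, spectralDensity_eq hβ hn hδ_odd hδ_even hγ hy]
      · rw [Set.indicator_of_notMem (show y ∉ spectralMoments n ⁻¹' A from hyA),
          Set.indicator_of_notMem hyA, mul_zero, mul_zero]
    simp only [h, Finset.sum_const, Finset.card_univ, nsmul_eq_mul, mul_assoc]
  · intro y hy
    by_contra hc
    refine hy ?_
    rw [Set.indicator_apply_eq_zero]
    exact fun _ => spectralDensity_eq_zero hβ (by simpa using hc)

end law

end RandomMoments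

end

/-! ### The density and its normalization -/

theorem mainTheorem11 {Ω : Type*} [MeasurableSpace Ω] (P : Measure Ω) [IsProbabilityMeasure P]
    (β : ℝ) (hβ : 0 < β) (n : ℕ) (hn : 1 ≤ n)
    (μ : Ω → Measure ℝ) (hμ : HasLaw μ (RandomMoments.gaussianSpectralLaw β n) P)
    (γ δ : ℕ → ℝ)
    (hδ_odd : ∀ k : ℕ, 1 ≤ k → k ≤ n → δ (2 * k - 1) = 1 / 2)
    (hδ_even : ∀ k : ℕ, 1 ≤ k → k ≤ n - 1 → δ (2 * k) = 1)
    (hγ : ∀ k : ℕ, 1 ≤ k → k ≤ n - 1 → γ k = (β / 2 - 2) * ((n : ℝ) - (k : ℝ))) :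
    HasLaw (fun ω => RandomMoments.momentVector (2 * n - 1) (μ ω))
      ((volume.restrict (RandomMoments.momentSpace (2 * n - 1))).withDensity fun m =>
        ENNReal.ofReal (RandomMoments.hDensity n γ δ m)) P := by
  have hmv := RandomMoments.measurable_momentVector (2 * n - 1)
  have hmap : P.map (fun ω => RandomMoments.momentVector (2 * n - 1) (μ ω)) =
      (RandomMoments.gaussianSpectralLaw β n).map (RandomMoments.momentVector (2 * n - 1)) := by
    rw [← hμ.map_eq, AEMeasurable.map_map_of_aemeasurable hmv.aemeasurable hμ.aemeasurable]
    rfl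
  refine ⟨hmv.comp_aemeasurable hμ.aemeasurable, ?_⟩
  have key := fun {A : Set (Fin (2 * n - 1) → ℝ)} (hA : MeasurableSet A) =>
    RandomMoments.map_momentVector_apply hβ hn hδ_odd hδ_even hγ hA
  rw [← hmap] at key
  have : IsProbabilityMeasure (P.map fun ω => RandomMoments.momentVector (2 * n - 1) (μ ω)) :=
    Measure.isProbabilityMeasure_map (hmv.comp_aemeasurable hμ.aemeasurable)
  -- Evaluating on the whole space, where both the law and `h` have mass one, shows that `n!` times
  -- `spectralConst` is one.
  have hone := key MeasurableSet.univ
  rw [measure_univ] at hone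
  simp only [Set.indicator_univ] at hone
  rw [RandomMoments.lintegral_hDensity hβ hn hδ_odd hδ_even hγ, mul_one] at hone
  ext A hA
  rw [key hA, ← hone, one_mul, RandomMoments.withDensity_momentSpace hn, withDensity_apply _ hA,
    lintegral_indicator hA]
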